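/- **Setting.** Identify Minkowski 3-space $\mathbb{E}^3_1=(\mathbb{R}^3,\ \langle u,v\rangle=-u_1v_1+u_2v_2+u_3v_3)$ with $\mathfrak{sl}(2,\mathbb{R})$ via $(u_1,u_2,u_3)\leftrightarrow u_1\mathbf{i}+u_2\mathbf{j}'+u_3\mathbf{k}'$, where $$\mathbf{i}=\begin{pmatrix}0&-1\\1&0\end{pmatrix},\quad \mathbf{j}'=\begin{pmatrix}0&1\\1&0\end{pmatrix},\quad \mathbf{k}'=\begin{pmatrix}-1&0\\0&1\end{pmatrix}.$$ Let $\tilde\Lambda G_\sigma$ be the group of loops $X(\lambda)=\sum_{j\in\mathbb{Z}}X_j\lambda^j$ with real $2\times2$ coefficients, convergent on $\mathbb{C}^*$, with $\det X(\lambda)=1$ and $\mathbf{k}'X(\lambda)\mathbf{k}'^{-1}=X(-\lambda)$. Let $\tilde\Lambda^{+}G_\sigma$ consist of those with only powers $\lambda^j$, $j\ge0$, and $\tilde\Lambda^{-}_{*}G_\sigma$ of those with only powers $j\le0$ and $X_0=\mathbf{1}$. A *null Frenet curve* with torsion $\tau$ is a smooth curve $\gamma(s)$ in $\mathbb{E}^3_1$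 on an open interval which has a smooth frame $A=\gamma',B,C$ along it with $\langle A,A\rangle=\langle B,B\rangle=\langle A,C\rangle=\langle B,C\rangle=0$, $\langle A,B\rangle=\langle C,C\rangle=1$ and, for some function $\kappa$, $A'=\kappa C$, $B'=\tau C$, $C'=-\tau A-\kappa B$. Its *B-scroll* is the ruled surface $(s,t)\mapsto\gamma(s)+tB(s)$, $t\in\mathbb{R}$. **Statement.** Let $H\neq0$ be real, let $I,J\subset\mathbb{R}$ be open intervals containing $0$, let $f:I\to\mathbb{R}$ and $g,R:J\to\mathbb{R}$ be smooth with $f$ and $g$ nowhere zero, and consider the potentials $$\xi'=\lambda\begin{pmatrix}0&-\frac H2 f(x)\\0&0\end{pmatrix}dx,\qquad \xi''=\lambda^{-1}\begin{pmatrix}0&-R(y)/g(y)\\ \frac H2 g(y)&0\end{pmatrix}dy .$$ 1. The initial value problems $d'\Phi_+=\Phi_+\xi'$, $\Phi_+(x=0)=\mathbf{1}$ on $I$ and $d''\Phi_-=\Phi_-\xi''$, $\Phi_-(y=0)=\mathbf{1}$ on $J$ (for all $\lambda\in\mathbb{C}^*$) have solutions with values in $\tilde\Lambda G_\sigma$.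 2. Let $D$ be the set of all $(x,y)\in I\times J$ for which there is a decomposition $(\Phi_+(x),\Phi_-(y))=(\Phi,\Phi)\,(L_-^{-1},L_+^{-1})$ with $\Phi\in\tilde\Lambda G_\sigma$, $L_-\in\tilde\Lambda^-_*G_\sigma$, $L_+\in\tilde\Lambda^+G_\sigma$. Then $D$ is open and contains $(0,0)$. 3. Let $\Phi=\Phi(x,y)$, $(x,y)\in D$, be the framing given by these decompositions, and let $\lambda=e^t$, $t\in\mathbb{R}$. Then the Sym formula $$\varphi_\lambda=-\frac1H\Big\{\frac{\partial\Phi}{\partial t}\Phi^{-1}+\frac12\Phi\,\mathbf{k}'\,\Phi^{-1}\Big\}$$ defines a smooth timelike surface $\varphi_\lambda:D\to\mathbb{E}^3_1$ of constant mean curvature $H$ with respect to the unit normal $N_\lambda=\Phi\,\mathbf{k}'\,\Phi^{-1}$, and $\varphi_\lambda$ is a B-scroll of a null Frenet curve with constant torsion $H$: there are a diffeomorphism $s=\sigma(y)$ from $J$ onto an open interval, a null Frenet curve $\gamma$ on $\sigma(J)$ with frame $(A,B,C)$ and constant torsion $\tau=H$, and a smooth function $q$ on $D$ with $\partial q/\partial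 x\ne0$, such that $(x,y)\mapsto(\sigma(y),q(x,y))$ is injective on $D$ (hence a diffeomorphism onto an open set) and $$\varphi_\lambda(x,y)=\gamma(\sigma(y))+q(x,y)\,B(\sigma(y))\qquad\text{on }D,$$ where, for all $y\in J$, $$\gamma(\sigma(y))=-\frac1H\Big\{\frac{\partial\Phi_-}{\partial t}\Phi_-^{-1}+\frac12\Phi_-\,\mathbf{k}'\,\Phi_-^{-1}\Big\}.$$ -/

import Mathlib

open scoped ContDiff

noncomputable section

namespace TimelikeCMC

/-! ### Minkowski 3-space and its identification with the Lie algebra of `SL(2, ℝ)` -/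

/-- The underlying vector space of Minkowski 3-space, with coordinates `(u₁, u₂, u₃)`. -/
abbrev E31 : Type := Fin 3 → ℝ

/-- The Lorentzian scalar product `-u₁v₁ + u₂v₂ + u₃v₃`. -/
def lor (u v : E31) : ℝ := -(u 0 * v 0) + u 1 * v 1 + u 2 * v 2

/-- Complex 2 by 2 matrices. -/
abbrev Mat2 : Type := Matrix (Fin 2) (Fin 2) ℂ

/-- The matrix `𝐢`. -/
def matI : Mat2 := !![0, -1; 1, 0]

/-- The matrix `𝐣'`. -/
def matJ : Mat2 := !![0, 1; 1, 0]

/-- The matrix `𝐤'`. -/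
def matK : Mat2 := !![-1, 0; 0, 1]

/-- The identification `(u₁, u₂, u₃) ↦ u₁ 𝐢 + u₂ 𝐣' + u₃ 𝐤'` of Minkowski 3-space with
`sl(2, ℝ)`, here regarded inside the complex matrices. -/
def toMat (u : E31) : Mat2 :=
  (u 0 : ℂ) • matI + (u 1 : ℂ) • matJ + (u 2 : ℂ) • matK

/-! ### Twisted loop groups -/

/-- A matrix valued function of the loop parameter. Only its values at nonzero parameters are
ever used: a loop on the unit circle is identified with its analytic extension to `ℂ \ {0}`. -/
abbrev Loop : Type := ℂ → Mat2

/-- `X(z) = ∑ⱼ cⱼ zʲ` on `ℂ \ {0}`, with real matrix coefficients `cⱼ`. -/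
def HasLaurent (c : ℤ → Matrix (Fin 2) (Fin 2) ℝ) (X : Loop) : Prop :=
  ∀ z : ℂ, z ≠ 0 → HasSum (fun j : ℤ => z ^ j • (c j).map Complex.ofReal) (X z)

/-- Determinant one and invariance under the twist: `Ad(𝐤') X(z) = X(-z)`. -/
def IsTwistedUnimodular (X : Loop) : Prop :=
  ∀ z : ℂ, z ≠ 0 → (X z).det = 1 ∧ matK * X z * matK⁻¹ = X (-z)

/-- The twisted loop group of `SL(2, ℝ)` with analytic extension to `ℂ \ {0}`. -/
def loopGroup : Set Loop :=
  {X | IsTwistedUnimodular X ∧ ∃ c, HasLaurent c X}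

/-- Loops with only nonnegative powers of the parameter. -/
def loopPlus : Set Loop :=
  {X | IsTwistedUnimodular X ∧ ∃ c, HasLaurent c X ∧ ∀ j < 0, c j = 0}

/-- Loops with only nonpositive powers of the parameter and constant term the identity. -/
def loopMinusStar : Set Loop :=
  {X | IsTwistedUnimodular X ∧ ∃ c, HasLaurent c X ∧ (∀ j > 0, c j = 0) ∧ c 0 = 1}

/-! ### Normalized potentials and the Weierstrass type representation -/

/-- The `dx`-coefficient of the normalized potential `ξ'` with data `H, Q, f`. -/
def xiPrime (H : ℝ) (Q f : ℝ → ℝ) (x : ℝ) : Loop := fun z =>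
  z • !![0, ((-(H / 2) * f x : ℝ) : ℂ); ((Q x / f x : ℝ) : ℂ), 0]

/-- The `dy`-coefficient of the normalized potential `ξ''` with data `H, R, g`. -/
def xiSecond (H : ℝ) (R g : ℝ → ℝ) (y : ℝ) : Loop := fun z =>
  z⁻¹ • !![0, ((-(R y / g y) : ℝ) : ℂ); ((H / 2 * g y : ℝ) : ℂ), 0]

/-- `Ψ` solves `dΨ = Ψ ξ`, `Ψ(0) = 1` on the open interval `I`, for all values of the loop
parameter. -/
def SolvesIVP (I : Set ℝ) (ξ Ψ : ℝ → Loop) : Prop :=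
  ∀ z : ℂ, z ≠ 0 → Ψ 0 z = 1 ∧
    ∀ x ∈ I, HasDerivAt (fun x' : ℝ => Ψ x' z) (Ψ x z * ξ x z) x

/-- `Φ` is the diagonal factor in the Iwasawa decomposition
`(X, Y) = (Φ, Φ) (L₋⁻¹, L₊⁻¹)`. -/
def IsIwasawaFactor (X Y Φ : Loop) : Prop :=
  Φ ∈ loopGroup ∧ ∃ Lm ∈ loopMinusStar, ∃ Lp ∈ loopPlus,
    ∀ z : ℂ, z ≠ 0 → X z = Φ z * (Lm z)⁻¹ ∧ Y z = Φ z * (Lp z)⁻¹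

/-- The points `(x, y)` of `I × J` at which `(Ψ'(x), Ψ''(y))` lies in the big cell, that is,
has an Iwasawa decomposition. -/
def bigCell (I J : Set ℝ) (Ψp Ψs : ℝ → Loop) : Set (ℝ × ℝ) :=
  {p | p ∈ I ×ˢ J ∧ ∃ Φ, IsIwasawaFactor (Ψp p.1) (Ψs p.2) Φ}

/-- `v` is the point of Minkowski 3-space given by the Sym formula
`-(1/H) (∂Φ/∂t Φ⁻¹ + (1/2) Ad(Φ) 𝐤')` at the parameter `exp t`. -/
def IsSymPoint (H : ℝ) (Φ : Loop) (t : ℝ) (v : E31) : Prop :=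
  ∃ Φt : Mat2,
    HasDerivAt (fun t' : ℝ => Φ ((Real.exp t' : ℝ) : ℂ)) Φt t ∧
    toMat v = (-(1 / (H : ℂ))) •
      (Φt * (Φ ((Real.exp t : ℝ) : ℂ))⁻¹ +
        (1 / 2 : ℂ) • (Φ ((Real.exp t : ℝ) : ℂ) * matK * (Φ ((Real.exp t : ℝ) : ℂ))⁻¹))

/-- `v` is the vector `Ad(Φ) 𝐤'` at the parameter `exp t`. -/
def IsGaussPoint (Φ : Loop) (t : ℝ) (v : E31) : Prop :=
  toMat v = Φ ((Real.exp t : ℝ) : ℂ) * matK * (Φ ((Real.exp t : ℝ) : ℂ))⁻¹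

/-! ### Timelike surfaces -/

/-- The coordinate vectors of the parameter plane. -/
def coordVec : Fin 2 → ℝ × ℝ := ![(1, 0), (0, 1)]

/-- Partial derivatives of a map on the parameter plane. -/
def pd (φ : ℝ × ℝ → E31) (i : Fin 2) (p : ℝ × ℝ) : E31 := fderiv ℝ φ p (coordVec i)

/-- The matrix of the first fundamental form. -/
def firstForm (φ : ℝ × ℝ → E31) (p : ℝ × ℝ) : Matrix (Fin 2) (Fin 2) ℝ :=
  Matrix.of fun i j => lor (pd φ i p) (pd φ j p)

/-- The matrix of the second fundamental form `-⟨dφ, dN⟩`. -/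
def secondForm (φ N : ℝ × ℝ → E31) (p : ℝ × ℝ) : Matrix (Fin 2) (Fin 2) ℝ :=
  Matrix.of fun i j => -lor (pd φ i p) (pd N j p)

/-- The mean curvature `(1/2) tr(II · I⁻¹)`. -/
def meanCurvature (φ N : ℝ × ℝ → E31) (p : ℝ × ℝ) : ℝ :=
  1 / 2 * (secondForm φ N p * (firstForm φ p)⁻¹).trace

/-- `φ` is a smooth timelike surface on the open set `D` (its induced metric is Lorentzian; in
particular `φ` is an immersion), with smooth unit normal field `N`, and its mean curvature with
respect to `N` is the constant `H`. -/
structure IsTimelikeCMC (D : Set (ℝ × ℝ)) (φ N : ℝ × ℝ → E31) (H : ℝ) : Prop where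
  smooth : ContDiffOn ℝ ∞ φ D
  smooth_normal : ContDiffOn ℝ ∞ N D
  timelike : ∀ p ∈ D, (firstForm φ p).det < 0
  unit : ∀ p ∈ D, lor (N p) (N p) = 1
  normal : ∀ p ∈ D, ∀ i, lor (pd φ i p) (N p) = 0
  cmc : ∀ p ∈ D, meanCurvature φ N p = H

/-! ### Null Frenet curves and B-scrolls -/

/-- `γ` is a null Frenet curve on the open interval `S`, with null Frenet frame field
`(A, B, C)`, curvature `κ` and torsion `τ`. -/
structure IsNullFrenet (S : Set ℝ) (γ A B C : ℝ → E31) (κ τ : ℝ → ℝ) : Prop where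
  isOpen : IsOpen S
  ordConnected : S.OrdConnected
  smooth_curve : ContDiffOn ℝ ∞ γ S
  smooth_A : ContDiffOn ℝ ∞ A S
  smooth_B : ContDiffOn ℝ ∞ B S
  smooth_C : ContDiffOn ℝ ∞ C S
  tangent : ∀ s ∈ S, HasDerivAt γ (A s) s
  AA : ∀ s ∈ S, lor (A s) (A s) = 0
  AB : ∀ s ∈ S, lor (A s) (B s) = 1
  BB : ∀ s ∈ S, lor (B s) (B s) = 0
  CC : ∀ s ∈ S, lor (C s) (C s) = 1
  AC : ∀ s ∈ S, lor (A s) (C s) = 0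
  BC : ∀ s ∈ S, lor (B s) (C s) = 0
  deriv_A : ∀ s ∈ S, HasDerivAt A (κ s • C s) s
  deriv_B : ∀ s ∈ S, HasDerivAt B (τ s • C s) s
  deriv_C : ∀ s ∈ S, HasDerivAt C (-(τ s) • A s - κ s • B s) s

/-- The ruled surface `(s, t) ↦ γ(s) + t B(s)`. -/
def bScroll (γ B : ℝ → E31) (p : ℝ × ℝ) : E31 := γ p.1 + p.2 • B p.1

/-- A change of parameters `(x, y) ↦ (σ(y), q(x, y))` on the open set `D ⊆ ℝ × J`: `σ` and `q`
are smooth, `σ' ≠ 0`, `∂q/∂x ≠ 0`, and the map is injective, so that it is a diffeomorphism from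
`D` onto an open set. -/
structure IsScrollParam (D : Set (ℝ × ℝ)) (J : Set ℝ) (σ : ℝ → ℝ) (q : ℝ × ℝ → ℝ) : Prop where
  smooth_base : ContDiffOn ℝ ∞ σ J
  smooth_ruling : ContDiffOn ℝ ∞ q D
  deriv_base : ∀ y ∈ J, deriv σ y ≠ 0
  deriv_ruling : ∀ p ∈ D, fderiv ℝ q p (1, 0) ≠ 0
  injOn : Set.InjOn (fun p : ℝ × ℝ => (σ p.2, q p)) D

end TimelikeCMC

end

noncomputable section

namespace TimelikeCMC

/-! ### Iterated integrals and the series solving an off-diagonal linear system -/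

/-! The potential `ξ'` is strictly upper triangular, so `Φ₊ = 1 + λ a(x) E₁₂` with `a' = -(H/2) f`.
The other solution has the form `Φ₋ = 1 + λ⁻¹ (p E₁₂ + b E₂₁) + O(λ⁻²)` with `b' = (H/2) g`. With
`Φ₊` this simple the splitting is explicit: it exists exactly when `1 - ab ≠ 0`, and then `Φ = Φ₋
L₊` where `L₊` has rows `((1-ab)⁻¹, λa)` and `(0, 1-ab)`. Existence compares Laurent coefficients
(`isIwasawaFactor_mul_gaugeLoop`). Uniqueness is Liouville's theorem
(`eq_gaugeLoop_of_isIwasawaFactor`): `L₊ = Φ₋⁻¹ Φ₊ L₋` extends to an entire function, and the right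
side shows its behaviour at infinity. Hence `D` is the open set `1 - ab ≠ 0`.

Since `L₊` is upper triangular, passing from `Φ₋` to `Φ₋ L₊` moves the Sym point only along `B = 2
Ad(Φ₋) E₁₂`, by `q = -(λ/H) a/(1-ab)` (`symVec_gauge`). The equation for `Φ₋` makes `A = Ad(Φ₋)
E₂₁`, `B`, `C = Ad(Φ₋) 𝐤'` a null Frenet frame of the base curve, of speed `λ⁻¹ g`, curvature `R/g²`
and torsion `H` (`hasDerivAt_symVec` and its neighbours). The normal is `C - HqB`. Thus `φ_x` is
null and `N_x = -H φ_x`, which already forces mean curvature `H` (`isTimelikeCMC_of_frame`).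

Analytically, `Φ₋` is a series of iterated integrals in powers of `λ⁻¹`; this one expression gives
the differential equation, the Laurent coefficients, convergence on `ℂ*` and the derivative in `λ`.
-/

/-- The sequence of weights `α, β, α, β, …`. -/
def alt (α β : ℝ → ℝ) (n : ℕ) : ℝ → ℝ := if Even n then α else β

/-- The iterated integrals with weights `α, β, α, β, …`, the innermost weight being `α`. -/
def iterInt (α β : ℝ → ℝ) : ℕ → ℝ → ℝ
  | 0 => fun _ => 1
  | n + 1 => fun y => ∫ x in (0 : ℝ)..y, alt α β n x * iterInt α β n x

/-- The series of iterated integrals with coefficients `a`. -/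
def iterSeries {E : Type*} [NormedAddCommGroup E] [NormedSpace ℝ E] (α β : ℝ → ℝ) (a : ℕ → E)
    (y : ℝ) : E := ∑' n, iterInt α β n y • a n

section Basic

variable {J : Set ℝ} {α β : ℝ → ℝ}

theorem hasDerivAt_integral_of_continuousOn {h : ℝ → ℝ} (hJo : IsOpen J) (hJc : J.OrdConnected)
    (hJ0 : (0 : ℝ) ∈ J) (hh : ContinuousOn h J) {y : ℝ} (hy : y ∈ J) :
    HasDerivAt (fun y => ∫ x in (0 : ℝ)..y, h x) (h y) y :=
  intervalIntegral.integral_hasDerivAt_right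
    ((hh.mono (hJc.uIcc_subset hJ0 hy)).intervalIntegrable)
    (hh.stronglyMeasurableAtFilter hJo y hy) (hh.continuousAt (hJo.mem_nhds hy))

theorem continuousOn_alt (hα : ContinuousOn α J) (hβ : ContinuousOn β J) (n : ℕ) :
    ContinuousOn (alt α β n) J := by
  unfold alt; split_ifs <;> assumption

@[simp] theorem iterInt_zero (y : ℝ) : iterInt α β 0 y = 1 := rfl

theorem iterInt_succ_zero (n : ℕ) : iterInt α β (n + 1) 0 = 0 := by simp [iterInt]

theorem continuousOn_iterInt (hJo : IsOpen J) (hJc : J.OrdConnected) (hJ0 : (0 : ℝ) ∈ J)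
    (hα : ContinuousOn α J) (hβ : ContinuousOn β J) (n : ℕ) : ContinuousOn (iterInt α β n) J := by
  induction n with
  | zero => exact continuousOn_const
  | succ n ih => exact fun y hy => (hasDerivAt_integral_of_continuousOn hJo hJc hJ0
      ((continuousOn_alt hα hβ n).mul ih) hy).continuousAt.continuousWithinAt

theorem hasDerivAt_iterInt_succ (hJo : IsOpen J) (hJc : J.OrdConnected) (hJ0 : (0 : ℝ) ∈ J)
    (hα : ContinuousOn α J) (hβ : ContinuousOn β J) (n : ℕ) {y : ℝ} (hy : y ∈ J) :
    HasDerivAt (iterInt α β (n + 1)) (alt α β n y * iterInt α β n y) y :=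
  hasDerivAt_integral_of_continuousOn hJo hJc hJ0
    ((continuousOn_alt hα hβ n).mul (continuousOn_iterInt hJo hJc hJ0 hα hβ n)) hy

/-- The domain of iteration is a simplex of volume `|y|ⁿ/n!`. The induction needs the weight bound
on the whole segment from `0`, which every subsegment inherits. -/
theorem abs_iterInt_le {M : ℝ} {y : ℝ} (hM : ∀ n, ∀ x ∈ Set.uIcc 0 y, |alt α β n x| ≤ M) (n : ℕ) :
    |iterInt α β n y| ≤ (M * |y|) ^ n / n.factorial := by
  have hM0 : 0 ≤ M := (abs_nonneg _).trans (hM 0 0 Set.left_mem_uIcc)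
  induction n generalizing y with
  | zero => simp
  | succ n ih =>
    have hint : Continuous fun x : ℝ => M * ((M * |x|) ^ n / n.factorial) := by fun_prop
    have h1 : |∫ x in (0 : ℝ)..y, alt α β n x * iterInt α β n x| ≤
        |∫ x in (0 : ℝ)..y, M * ((M * |x|) ^ n / n.factorial)| := by
      refine intervalIntegral.norm_integral_le_abs_of_norm_le
        (E := ℝ) (μ := MeasureTheory.volume) ?_ (hint.intervalIntegrable _ _)
      refine (MeasureTheory.ae_restrict_iff' measurableSet_uIoc).2 (Filter.Eventually.of_forall ?_)
      intro x hx
      have hx' := Set.uIoc_subset_uIcc hx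
      rw [Real.norm_eq_abs, abs_mul]
      exact mul_le_mul (hM n x hx') (ih fun m z hz => hM m z
        (Set.uIcc_subset_uIcc Set.left_mem_uIcc hx' hz)) (abs_nonneg _) hM0
    refine h1.trans (le_of_eq ?_)
    rw [← Real.norm_eq_abs, intervalIntegral.norm_integral_eq_norm_integral_uIoc, Real.norm_eq_abs]
    have h2 : ∀ x : ℝ, M * ((M * |x|) ^ n / n.factorial) =
        (M ^ (n + 1) / n.factorial) * |x - 0| ^ n := by
      intro x; rw [sub_zero, mul_pow]; ring
    simp_rw [h2]
    rw [MeasureTheory.integral_const_mul, integral_pow_abs_sub_uIoc, sub_zero,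
      abs_of_nonneg (by positivity), Nat.factorial_succ, mul_pow]
    push_cast
    field_simp

/-- Termwise differentiation needs one bound on a connected neighbourhood containing both `0` and
`y`; a thickening of the segment with closure in `J` serves. The factor `max L 1` lets the same `M`
dominate both the weights and weight times length. -/
theorem exists_majorant (hJo : IsOpen J) (hJc : J.OrdConnected) (hJ0 : (0 : ℝ) ∈ J)
    (hα : ContinuousOn α J) (hβ : ContinuousOn β J) {y : ℝ} (hy : y ∈ J) :
    ∃ t : Set ℝ, IsOpen t ∧ IsPreconnected t ∧ 0 ∈ t ∧ y ∈ t ∧ t ⊆ J ∧ ∃ M : ℝ, 0 ≤ M ∧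
      ∀ n, ∀ x ∈ t, |alt α β n x| ≤ M ∧ |iterInt α β n x| ≤ M ^ n / n.factorial := by
  obtain ⟨δ, hδ, hsub⟩ := isCompact_uIcc.exists_cthickening_subset_open hJo
    (hJc.uIcc_subset hJ0 hy)
  have hK : IsCompact (Metric.cthickening δ (Set.uIcc 0 y)) := isCompact_uIcc.cthickening
  obtain ⟨M₁, h₁⟩ := hK.exists_bound_of_continuousOn (hα.mono hsub)
  obtain ⟨M₂, h₂⟩ := hK.exists_bound_of_continuousOn (hβ.mono hsub)
  obtain ⟨L, hL⟩ := hK.isBounded.exists_norm_le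
  have h0 : (0 : ℝ) ∈ Metric.thickening δ (Set.uIcc 0 y) :=
    Metric.self_subset_thickening hδ _ Set.left_mem_uIcc
  have hconv : Convex ℝ (Metric.thickening δ (Set.uIcc 0 y)) := (convex_uIcc 0 y).thickening δ
  have hthc := Metric.thickening_subset_cthickening δ (Set.uIcc 0 y)
  have hb : ∀ n, ∀ x ∈ Metric.thickening δ (Set.uIcc 0 y), |alt α β n x| ≤ max M₁ M₂ := by
    intro n x hx
    unfold alt
    split_ifs
    · exact (h₁ x (hthc hx)).trans (le_max_left _ _)
    · exact (h₂ x (hthc hx)).trans (le_max_right _ _)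
  have hM0 : 0 ≤ max M₁ M₂ := (abs_nonneg _).trans (hb 0 0 h0)
  refine ⟨_, Metric.isOpen_thickening, hconv.isPreconnected, h0,
    Metric.self_subset_thickening hδ _ Set.right_mem_uIcc, hthc.trans hsub,
    max M₁ M₂ * max L 1, by positivity, fun n x hx => ⟨(hb n x hx).trans ?_, ?_⟩⟩
  · exact le_mul_of_one_le_right hM0 (le_max_right _ _)
  · refine (abs_iterInt_le (fun m z hz => hb m z
      (hconv.ordConnected.uIcc_subset h0 hx hz)) n).trans ?_
    gcongr
    exact (hL x (hthc hx)).trans (le_max_left _ _)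

end Basic

section Series

variable {J : Set ℝ} {α β : ℝ → ℝ} {E : Type*} [NormedAddCommGroup E] [NormedSpace ℝ E]

theorem iterSeries_zero (a : ℕ → E) : iterSeries α β a 0 = a 0 := by
  unfold iterSeries
  rw [tsum_eq_single 0]
  · simp
  · intro n hn
    obtain ⟨m, rfl⟩ := Nat.exists_eq_succ_of_ne_zero hn
    rw [Nat.succ_eq_add_one, iterInt_succ_zero, zero_smul]

variable [CompleteSpace E]

theorem summable_iterInt_smul (hJo : IsOpen J) (hJc : J.OrdConnected) (hJ0 : (0 : ℝ) ∈ J)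
    (hα : ContinuousOn α J) (hβ : ContinuousOn β J) {a : ℕ → E} {C ρ : ℝ}
    (ha : ∀ n, ‖a n‖ ≤ C * ρ ^ n) {y : ℝ} (hy : y ∈ J) :
    Summable fun n => iterInt α β n y • a n := by
  obtain ⟨t, -, -, -, hyt, -, M, hM, hb⟩ := exists_majorant hJo hJc hJ0 hα hβ hy
  refine Summable.of_norm_bounded
    ((Real.summable_pow_div_factorial (M * ρ)).mul_left C) fun n => ?_
  rw [norm_smul, Real.norm_eq_abs]
  calc |iterInt α β n y| * ‖a n‖ ≤ M ^ n / n.factorial * (C * ρ ^ n) :=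
        mul_le_mul (hb n y hyt).2 (ha n) (norm_nonneg _) (by positivity)
    _ = _ := by rw [mul_pow]; ring

theorem hasDerivAt_iterSeries (hJo : IsOpen J) (hJc : J.OrdConnected) (hJ0 : (0 : ℝ) ∈ J)
    (hα : ContinuousOn α J) (hβ : ContinuousOn β J) {a : ℕ → E} {C ρ : ℝ}
    (ha : ∀ n, ‖a n‖ ≤ C * ρ ^ n) {y : ℝ} (hy : y ∈ J) :
    HasDerivAt (iterSeries α β a)
      (∑' n, (alt α β n y * iterInt α β n y) • a (n + 1)) y := by
  obtain ⟨t, hto, htp, h0t, hyt, htJ, M, hM, hb⟩ := exists_majorant hJo hJc hJ0 hα hβ hy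
  -- The term of index `0` is constant, so differentiation shifts the series by one index.
  set g' : ℕ → ℝ → E := fun n x =>
    Nat.casesOn n 0 fun m => (alt α β m x * iterInt α β m x) • a (m + 1) with hg'
  set u : ℕ → ℝ := fun n => Nat.casesOn n 0 fun m => M * (M ^ m / m.factorial) * (C * ρ ^ (m + 1))
  have hu : Summable u := by
    rw [← summable_nat_add_iff 1]
    refine ((Real.summable_pow_div_factorial (M * ρ)).mul_left (M * C * ρ)).congr fun m => ?_
    show M * C * ρ * ((M * ρ) ^ m / m.factorial) = M * (M ^ m / m.factorial) * (C * ρ ^ (m + 1))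
    rw [mul_pow]; ring
  have hle : ∀ n, ∀ x ∈ t, ‖g' n x‖ ≤ u n := by
    rintro (_ | m) x hx
    · simp [hg', u]
    · show ‖(alt α β m x * iterInt α β m x) • a (m + 1)‖ ≤
        M * (M ^ m / m.factorial) * (C * ρ ^ (m + 1))
      rw [norm_smul, Real.norm_eq_abs, abs_mul]
      gcongr
      · exact (hb m x hx).1
      · exact (hb m x hx).2
      · exact ha _
  have key := hasDerivAt_tsum_of_isPreconnected (𝕜 := ℝ) (F := E)
    (g := fun n x => iterInt α β n x • a n) (g' := g')
    hu hto htp ?_ hle h0t (summable_iterInt_smul hJo hJc hJ0 hα hβ ha hJ0) hyt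
  · refine key.congr_deriv ?_
    rw [(Summable.of_norm_bounded hu fun n => hle n y hyt).tsum_eq_zero_add]
    exact zero_add _
  · rintro (_ | m) x hx
    · exact hasDerivAt_const x ((1 : ℝ) • a 0)
    · exact (hasDerivAt_iterInt_succ hJo hJc hJ0 hα hβ m (htJ hx)).smul_const _

end Series

/-! ### Coefficient sequences for the diagonal and off-diagonal entries, and their parameter
derivatives. -/

section Power

variable {𝕜 : Type*} [RCLike 𝕜]

/-- The coefficients `1, 0, w², 0, w⁴, …`. -/
def evenPow (w : 𝕜) (n : ℕ) : 𝕜 := if Even n then w ^ n else 0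

/-- The coefficients `0, w, 0, w³, 0, …`. -/
def oddPow (w : 𝕜) (n : ℕ) : 𝕜 := if Even n then 0 else w ^ n

/-- The derivative of `evenPow`. -/
def evenPow' (w : 𝕜) (n : ℕ) : 𝕜 := if Even n then n * w ^ (n - 1) else 0

/-- The derivative of `oddPow`. -/
def oddPow' (w : 𝕜) (n : ℕ) : 𝕜 := if Even n then 0 else n * w ^ (n - 1)

theorem norm_evenPow_le (w : 𝕜) (n : ℕ) : ‖evenPow w n‖ ≤ 1 * ‖w‖ ^ n := by
  unfold evenPow; split_ifs <;> simp

theorem norm_oddPow_le (w : 𝕜) (n : ℕ) : ‖oddPow w n‖ ≤ 1 * ‖w‖ ^ n := by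
  unfold oddPow; split_ifs <;> simp

/-- Puts the differentiated powers back under a geometric bound, so that the general series lemmas
apply to them with ratio `r + 1`. -/
theorem nat_mul_pow_pred_le {r : ℝ} (hr : 0 ≤ r) (n : ℕ) :
    (n : ℝ) * r ^ (n - 1) ≤ 1 * (r + 1) ^ n := by
  rw [one_mul]
  induction n with
  | zero => simp
  | succ n ih =>
    have h1 : (n : ℝ) * r ^ n ≤ r * (r + 1) ^ n := by
      rcases n with _ | n
      · simpa using hr
      · calc ((n + 1 : ℕ) : ℝ) * r ^ (n + 1) = r * (((n + 1 : ℕ) : ℝ) * r ^ (n + 1 - 1)) := by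
              rw [Nat.add_sub_cancel]; ring
          _ ≤ _ := by gcongr
    have h2 : r ^ n ≤ (r + 1) ^ n := by gcongr; linarith
    rw [Nat.add_sub_cancel, pow_succ]
    push_cast
    linarith

theorem norm_nat_mul_pow_pred_le (w : 𝕜) (n : ℕ) :
    ‖(n : 𝕜) * w ^ (n - 1)‖ ≤ 1 * (‖w‖ + 1) ^ n := by
  simpa using nat_mul_pow_pred_le (norm_nonneg w) n

theorem norm_evenPow'_le (w : 𝕜) (n : ℕ) : ‖evenPow' w n‖ ≤ 1 * (‖w‖ + 1) ^ n := by
  unfold evenPow'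
  split_ifs
  · exact norm_nat_mul_pow_pred_le w n
  · rw [norm_zero]; positivity

theorem norm_oddPow'_le (w : 𝕜) (n : ℕ) : ‖oddPow' w n‖ ≤ 1 * (‖w‖ + 1) ^ n := by
  unfold oddPow'
  split_ifs
  · rw [norm_zero]; positivity
  · exact norm_nat_mul_pow_pred_le w n

end Power

/-! ### The solution entries as functions of position and of the parameter `w = λ⁻¹`. -/

section System

variable {𝕜 : Type*} [RCLike 𝕜] {J : Set ℝ} {α β : ℝ → ℝ}

/-- The first entry of the row `(p, q)` with `p' = w β q`, `q' = w α p`, `(p, q)(0) = (1, 0)`. -/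
def rowP (α β : ℝ → ℝ) (w : 𝕜) : ℝ → 𝕜 := iterSeries α β (evenPow w)

/-- The second entry of the row `(p, q)` with `p' = w β q`, `q' = w α p`, `(p, q)(0) = (1, 0)`. -/
def rowQ (α β : ℝ → ℝ) (w : 𝕜) : ℝ → 𝕜 := iterSeries α β (oddPow w)

/-- The derivative of `rowP` in the parameter `w`. -/
def rowP' (α β : ℝ → ℝ) (w : 𝕜) : ℝ → 𝕜 := iterSeries α β (evenPow' w)

/-- The derivative of `rowQ` in the parameter `w`. -/
def rowQ' (α β : ℝ → ℝ) (w : 𝕜) : ℝ → 𝕜 := iterSeries α β (oddPow' w)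

theorem rowP_zero (w : 𝕜) : rowP α β w 0 = 1 := by
  rw [rowP, iterSeries_zero]; simp [evenPow]

theorem rowQ_zero (w : 𝕜) : rowQ α β w 0 = 0 := by
  rw [rowQ, iterSeries_zero]; simp [oddPow]

/-- At real parameters the frame is real, which is what lets the Sym formula produce points of
Minkowski space. -/
theorem rowP_ofReal (w y : ℝ) : rowP α β (w : ℂ) y = (rowP α β w y : ℝ) := by
  unfold rowP iterSeries
  rw [Complex.ofReal_tsum]
  refine tsum_congr fun n => ?_
  unfold evenPow; split_ifs <;> simp

theorem rowQ_ofReal (w y : ℝ) : rowQ α β (w : ℂ) y = (rowQ α β w y : ℝ) := by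
  unfold rowQ iterSeries
  rw [Complex.ofReal_tsum]
  refine tsum_congr fun n => ?_
  unfold oddPow; split_ifs <;> simp

variable (hJo : IsOpen J) (hJc : J.OrdConnected) (hJ0 : (0 : ℝ) ∈ J)
  (hα : ContinuousOn α J) (hβ : ContinuousOn β J) {y : ℝ} (hy : y ∈ J)
include hJo hJc hJ0 hα hβ hy

theorem hasDerivAt_rowP (w : 𝕜) : HasDerivAt (rowP α β w) (β y • (w * rowQ α β w y)) y := by
  refine (hasDerivAt_iterSeries hJo hJc hJ0 hα hβ (norm_evenPow_le w) hy).congr_deriv ?_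
  rw [rowQ, iterSeries, ← tsum_mul_left, ← tsum_const_smul'']
  refine tsum_congr fun n => ?_
  by_cases hn : Even n
  · simp [evenPow, oddPow, hn, Nat.even_add_one]
  · simp [evenPow, oddPow, hn, alt, Nat.even_add_one, mul_smul, pow_succ, mul_comm]

theorem hasDerivAt_rowQ (w : 𝕜) : HasDerivAt (rowQ α β w) (α y • (w * rowP α β w y)) y := by
  refine (hasDerivAt_iterSeries hJo hJc hJ0 hα hβ (norm_oddPow_le w) hy).congr_deriv ?_
  rw [rowP, iterSeries, ← tsum_mul_left, ← tsum_const_smul'']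
  refine tsum_congr fun n => ?_
  by_cases hn : Even n
  · simp [evenPow, oddPow, hn, alt, Nat.even_add_one, mul_smul, pow_succ, mul_comm]
  · simp [evenPow, oddPow, hn, Nat.even_add_one]

/-- This is `p' = w β q` differentiated in `w`: the same linear system with an inhomogeneous term.
-/
theorem hasDerivAt_rowP' (w : 𝕜) :
    HasDerivAt (rowP' α β w) (β y • (w * rowQ' α β w y + rowQ α β w y)) y := by
  refine (hasDerivAt_iterSeries hJo hJc hJ0 hα hβ (norm_evenPow'_le w) hy).congr_deriv ?_
  rw [rowQ', rowQ, iterSeries, iterSeries, ← tsum_mul_left, ← Summable.tsum_add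
    ((summable_iterInt_smul hJo hJc hJ0 hα hβ (norm_oddPow'_le w) hy).mul_left w)
    (summable_iterInt_smul hJo hJc hJ0 hα hβ (norm_oddPow_le w) hy), ← tsum_const_smul'']
  refine tsum_congr fun n => ?_
  by_cases hn : Even n
  · simp [evenPow', oddPow', oddPow, hn, Nat.even_add_one]
  · obtain ⟨m, rfl⟩ : ∃ m, n = m + 1 := Nat.exists_eq_succ_of_ne_zero (by rintro rfl; simp at hn)
    simp only [evenPow', oddPow', oddPow, hn, alt, Nat.even_add_one, if_false, not_false_eq_true,
      if_true, Nat.add_sub_cancel, RCLike.real_smul_eq_coe_mul]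
    push_cast
    ring

theorem hasDerivAt_rowQ' (w : 𝕜) :
    HasDerivAt (rowQ' α β w) (α y • (w * rowP' α β w y + rowP α β w y)) y := by
  refine (hasDerivAt_iterSeries hJo hJc hJ0 hα hβ (norm_oddPow'_le w) hy).congr_deriv ?_
  rw [rowP', rowP, iterSeries, iterSeries, ← tsum_mul_left, ← Summable.tsum_add
    ((summable_iterInt_smul hJo hJc hJ0 hα hβ (norm_evenPow'_le w) hy).mul_left w)
    (summable_iterInt_smul hJo hJc hJ0 hα hβ (norm_evenPow_le w) hy), ← tsum_const_smul'']
  refine tsum_congr fun n => ?_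
  by_cases hn : Even n
  · rcases n with _ | m
    · simp [evenPow', oddPow', evenPow, alt]
    have hm : ¬ Even m := by simpa [Nat.even_add_one] using hn
    simp only [evenPow', oddPow', evenPow, hm, alt, Nat.even_add_one, if_false, not_false_eq_true,
      not_true_eq_false, if_true, Nat.add_sub_cancel, RCLike.real_smul_eq_coe_mul]
    push_cast
    ring
  · simp [evenPow', oddPow', evenPow, hn, Nat.even_add_one]

/-- On the ball of radius `‖w‖ + 1` the differentiated coefficients are at most `(‖w‖ + 2)ⁿ`, and
the factorials of the iterated integrals make the series converge uniformly there. -/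
theorem hasDerivAt_iterSeries_param {c c' : 𝕜 → ℕ → 𝕜}
    (hc : ∀ w n, HasDerivAt (fun v => c v n) (c' w n) w)
    (hle : ∀ w n, ‖c w n‖ ≤ 1 * ‖w‖ ^ n) (hle' : ∀ w n, ‖c' w n‖ ≤ 1 * (‖w‖ + 1) ^ n) (w : 𝕜) :
    HasDerivAt (fun v => iterSeries α β (c v) y) (iterSeries α β (c' w) y) w := by
  obtain ⟨t, -, -, -, hyt, -, M, hM, hb⟩ := exists_majorant hJo hJc hJ0 hα hβ hy
  refine hasDerivAt_tsum_of_isPreconnected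
    (Real.summable_pow_div_factorial (M * (‖w‖ + 2))) (Metric.isOpen_ball (x := (0 : 𝕜))
      (ε := ‖w‖ + 1)) (convex_ball (0 : 𝕜) (‖w‖ + 1)).isPreconnected
    (fun n v _ => (hc v n).const_smul (iterInt α β n y)) (fun n v hv => ?_) (y₀ := w) (by simp)
    (summable_iterInt_smul hJo hJc hJ0 hα hβ (hle w) hy) (by simp)
  have hv' : ‖v‖ ≤ ‖w‖ + 1 := by simpa using (Metric.mem_ball.1 hv).le
  rw [norm_smul, Real.norm_eq_abs]
  calc |iterInt α β n y| * ‖c' v n‖ ≤ M ^ n / n.factorial * (1 * (‖v‖ + 1) ^ n) :=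
        mul_le_mul (hb n y hyt).2 (hle' v n) (norm_nonneg _) (by positivity)
    _ ≤ M ^ n / n.factorial * (1 * (‖w‖ + 2) ^ n) := by
        gcongr M ^ n / n.factorial * (1 * ?_ ^ n); linarith
    _ = _ := by rw [mul_pow]; ring

theorem hasDerivAt_rowP_param (w : 𝕜) :
    HasDerivAt (fun v => rowP α β v y) (rowP' α β w y) w := by
  refine hasDerivAt_iterSeries_param hJo hJc hJ0 hα hβ hy (fun v n => ?_)
    norm_evenPow_le norm_evenPow'_le w
  unfold evenPow evenPow'
  split_ifs
  · exact hasDerivAt_pow n v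
  · exact hasDerivAt_const v _

theorem hasDerivAt_rowQ_param (w : 𝕜) :
    HasDerivAt (fun v => rowQ α β v y) (rowQ' α β w y) w := by
  refine hasDerivAt_iterSeries_param hJo hJc hJ0 hα hβ hy (fun v n => ?_)
    norm_oddPow_le norm_oddPow'_le w
  unfold oddPow oddPow'
  split_ifs
  · exact hasDerivAt_const v _
  · exact hasDerivAt_pow n v

end System

open Filter Topology

/-! ### Linear systems with off-diagonal coefficients -/

theorem hasDerivAt_mat {F : ℝ → Mat2} {F' : Mat2} {x : ℝ} :
    HasDerivAt F F' x ↔ ∀ i j, HasDerivAt (fun y => F y i j) (F' i j) x := by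
  let _ : NormedAddCommGroup Mat2 := Matrix.normedAddCommGroup
  let _ : NormedSpace ℝ Mat2 := Matrix.normedSpace
  exact (hasDerivAt_pi (E' := fun _ : Fin 2 => Fin 2 → ℂ)).trans
    (forall_congr' fun i => hasDerivAt_pi (E' := fun _ : Fin 2 => ℂ))

section Uniqueness

variable {J : Set ℝ} {A B : ℝ → ℂ}

theorem eqOn_const_of_hasDerivAt_zero (hJo : IsOpen J) (hJc : J.OrdConnected)
    (hJ0 : (0 : ℝ) ∈ J) {h : ℝ → ℂ} (hh : ∀ y ∈ J, HasDerivAt h 0 y) {y : ℝ} (hy : y ∈ J) :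
    h y = h 0 :=
  hJo.is_const_of_deriv_eq_zero hJc.isPreconnected
    (fun y hy => (hh y hy).differentiableAt.differentiableWithinAt) (fun y hy => (hh y hy).deriv)
    hy hJ0

/-- The coefficient matrix is trace free, so the area form of two row solutions is constant. The
rows may come from different matrix solutions, which is how uniqueness follows. -/
theorem rows_det_eq (hJo : IsOpen J) (hJc : J.OrdConnected) (hJ0 : (0 : ℝ) ∈ J) {p q r s : ℝ → ℂ}
    (hp : ∀ y ∈ J, HasDerivAt p (q y * B y) y) (hq : ∀ y ∈ J, HasDerivAt q (p y * A y) y)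
    (hr : ∀ y ∈ J, HasDerivAt r (s y * B y) y) (hs : ∀ y ∈ J, HasDerivAt s (r y * A y) y)
    {y : ℝ} (hy : y ∈ J) : p y * s y - q y * r y = p 0 * s 0 - q 0 * r 0 :=
  eqOn_const_of_hasDerivAt_zero (h := fun y => p y * s y - q y * r y) hJo hJc hJ0 (fun x hx =>
    (((hp x hx).mul (hs x hx)).sub ((hq x hx).mul (hr x hx))).congr_deriv (by ring)) hy

/-- `Ψ` solves `Ψ' = Ψ ξ`, `Ψ(0) = 1`, with `ξ` off-diagonal with entries `A`, `B`. -/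
def SolvesOffDiag (J : Set ℝ) (A B : ℝ → ℂ) (Ψ : ℝ → Mat2) : Prop :=
  Ψ 0 = 1 ∧ ∀ y ∈ J, HasDerivAt Ψ (Ψ y * !![0, A y; B y, 0]) y

theorem solvesOffDiag_iff {Ψ : ℝ → Mat2} : SolvesOffDiag J A B Ψ ↔
    Ψ 0 = 1 ∧ ∀ y ∈ J, ∀ i, HasDerivAt (fun y => Ψ y i 0) (Ψ y i 1 * B y) y ∧
      HasDerivAt (fun y => Ψ y i 1) (Ψ y i 0 * A y) y := by
  unfold SolvesOffDiag
  simp only [hasDerivAt_mat, Fin.forall_fin_two, Matrix.mul_apply, Fin.sum_univ_two]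
  simp

theorem SolvesOffDiag.det_eq_one (hJo : IsOpen J) (hJc : J.OrdConnected) (hJ0 : (0 : ℝ) ∈ J)
    {Ψ : ℝ → Mat2} (h : SolvesOffDiag J A B Ψ) {y : ℝ} (hy : y ∈ J) : (Ψ y).det = 1 := by
  obtain ⟨h0, h1⟩ := solvesOffDiag_iff.1 h
  rw [Matrix.det_fin_two, rows_det_eq hJo hJc hJ0 (p := fun y => Ψ y 0 0) (q := fun y => Ψ y 0 1)
    (r := fun y => Ψ y 1 0) (s := fun y => Ψ y 1 1) (fun x hx => (h1 x hx 0).1)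
    (fun x hx => (h1 x hx 0).2) (fun x hx => (h1 x hx 1).1) (fun x hx => (h1 x hx 1).2) hy, h0]
  simp

/-- The pairings of rows of `Ψ` with rows of `S` are the entries of `Ψ S⁻¹` up to order and sign,
and they keep their initial values. No regularity of `A` or `B` enters. -/
theorem SolvesOffDiag.unique (hJo : IsOpen J) (hJc : J.OrdConnected) (hJ0 : (0 : ℝ) ∈ J)
    {Ψ S : ℝ → Mat2} (hΨ : SolvesOffDiag J A B Ψ) (hS : SolvesOffDiag J A B S)
    {y : ℝ} (hy : y ∈ J) : Ψ y = S y := by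
  have hd := hS.det_eq_one hJo hJc hJ0 hy
  rw [Matrix.det_fin_two] at hd
  obtain ⟨h0, h1⟩ := solvesOffDiag_iff.1 hΨ
  obtain ⟨k0, k1⟩ := solvesOffDiag_iff.1 hS
  have key : ∀ i l, Ψ y i 0 * S y l 1 - Ψ y i 1 * S y l 0 =
      Ψ 0 i 0 * S 0 l 1 - Ψ 0 i 1 * S 0 l 0 := fun i l =>
    rows_det_eq hJo hJc hJ0 (p := fun y => Ψ y i 0) (q := fun y => Ψ y i 1)
      (r := fun y => S y l 0) (s := fun y => S y l 1) (fun x hx => (h1 x hx i).1)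
      (fun x hx => (h1 x hx i).2) (fun x hx => (k1 x hx l).1) (fun x hx => (k1 x hx l).2) hy
  have e00 := key 0 0
  have e01 := key 0 1
  have e10 := key 1 0
  have e11 := key 1 1
  simp [h0, k0] at e00 e01 e10 e11
  ext i j
  fin_cases i <;> fin_cases j <;> simp only [Fin.zero_eta, Fin.mk_one]
  · linear_combination (-Ψ y 0 0) * hd + S y 0 0 * e01 - S y 1 0 * e00
  · linear_combination (-Ψ y 0 1) * hd + S y 0 1 * e01 - S y 1 1 * e00
  · linear_combination (-Ψ y 1 0) * hd + S y 0 0 * e11 - S y 1 0 * e10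
  · linear_combination (-Ψ y 1 1) * hd + S y 0 1 * e11 - S y 1 1 * e10

end Uniqueness

/-! ### Twisted loops -/

theorem matK_inv : matK⁻¹ = matK := by
  refine Matrix.inv_eq_left_inv ?_
  ext i j
  fin_cases i <;> fin_cases j <;> simp [matK, Matrix.mul_apply]

theorem matK_conj (M : Mat2) : matK * M * matK⁻¹ = !![M 0 0, -M 0 1; -M 1 0, M 1 1] := by
  rw [matK_inv]
  ext i j
  fin_cases i <;> fin_cases j <;> simp only [Matrix.mul_apply, Fin.sum_univ_two] <;> simp [matK]

theorem IsTwistedUnimodular.mul {X Y : Loop} (hX : IsTwistedUnimodular X)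
    (hY : IsTwistedUnimodular Y) : IsTwistedUnimodular fun z => X z * Y z := by
  intro z hz
  refine ⟨by rw [Matrix.det_mul, (hX z hz).1, (hY z hz).1, one_mul], ?_⟩
  have hk : matK * matK = 1 := by
    ext i j
    fin_cases i <;> fin_cases j <;> simp [matK, Matrix.mul_apply]
  show matK * (X z * Y z) * matK⁻¹ = X (-z) * Y (-z)
  rw [← (hX z hz).2, ← (hY z hz).2, matK_inv]
  calc matK * (X z * Y z) * matK = matK * X z * 1 * Y z * matK := by simp only [mul_one, mul_assoc]
    _ = _ := by rw [← hk]; simp only [mul_assoc]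

theorem isTwistedUnimodular_of_entries {X : Loop} (hd : ∀ z ≠ 0, (X z).det = 1)
    (h00 : ∀ z ≠ 0, X (-z) 0 0 = X z 0 0) (h01 : ∀ z ≠ 0, X (-z) 0 1 = -X z 0 1)
    (h10 : ∀ z ≠ 0, X (-z) 1 0 = -X z 1 0) (h11 : ∀ z ≠ 0, X (-z) 1 1 = X z 1 1) :
    IsTwistedUnimodular X := by
  refine fun z hz => ⟨hd z hz, ?_⟩
  rw [matK_conj, ← h00 z hz, ← h01 z hz, ← h10 z hz, ← h11 z hz]
  exact (Matrix.eta_fin_two _).symm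

/-! ### Laurent series -/

theorem HasLaurent.congr {c : ℤ → Matrix (Fin 2) (Fin 2) ℝ} {X Y : Loop} (h : HasLaurent c X)
    (hXY : ∀ z ≠ 0, Y z = X z) : HasLaurent c Y := fun z hz => (hXY z hz).symm ▸ h z hz

theorem HasLaurent.const (E : Matrix (Fin 2) (Fin 2) ℝ) :
    HasLaurent (fun j => if j = 0 then E else 0) fun _ => E.map Complex.ofReal := by
  intro z _
  convert hasSum_single (f := fun j : ℤ => z ^ j • (if j = 0 then E else 0).map Complex.ofReal) 0
    (fun j hj => by simp [hj]) using 1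
  simp

/-- A loop that is a polynomial of degree at most one. -/
def linLoop (E₀ E₁ : Matrix (Fin 2) (Fin 2) ℝ) : Loop := fun z =>
  E₀.map Complex.ofReal + z • E₁.map Complex.ofReal

theorem map_ofReal_mul (M N : Matrix (Fin 2) (Fin 2) ℝ) :
    (M * N).map Complex.ofReal = M.map Complex.ofReal * N.map Complex.ofReal :=
  Matrix.map_mul (f := Complex.ofRealHom)

theorem map_ofReal_add (M N : Matrix (Fin 2) (Fin 2) ℝ) :
    (M + N).map Complex.ofReal = M.map Complex.ofReal + N.map Complex.ofReal :=
  Matrix.map_add _ Complex.ofReal_add M N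

/-- Every product whose coefficients are needed has a factor of degree at most one, so two shifted
series replace a convolution of bilateral series. -/
theorem HasLaurent.mul_linLoop {c : ℤ → Matrix (Fin 2) (Fin 2) ℝ} {X : Loop} (h : HasLaurent c X)
    (E₀ E₁ : Matrix (Fin 2) (Fin 2) ℝ) :
    HasLaurent (fun j => c j * E₀ + c (j - 1) * E₁) fun z => X z * linLoop E₀ E₁ z := by
  intro z hz
  have h0 := (h z hz).mul_right (E₀.map Complex.ofReal)
  have h1 := ((h z hz).mul_right (E₁.map Complex.ofReal)).const_smul z
  rw [← (Equiv.subRight (1 : ℤ)).hasSum_iff] at h1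
  convert h0.add h1 using 1
  · rfl
  · funext j
    simp only [Function.comp, Equiv.subRight_apply, map_ofReal_add, map_ofReal_mul, smul_add,
      smul_mul_assoc, smul_smul]
    rw [← zpow_one_add₀ hz]
    ring_nf
  · simp [linLoop, mul_add]

theorem HasLaurent.linLoop_mul {c : ℤ → Matrix (Fin 2) (Fin 2) ℝ} {X : Loop} (h : HasLaurent c X)
    (E₀ E₁ : Matrix (Fin 2) (Fin 2) ℝ) :
    HasLaurent (fun j => E₀ * c j + E₁ * c (j - 1)) fun z => linLoop E₀ E₁ z * X z := by
  intro z hz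
  have h0 := (h z hz).mul_left (E₀.map Complex.ofReal)
  have h1 := ((h z hz).mul_left (E₁.map Complex.ofReal)).const_smul z
  rw [← (Equiv.subRight (1 : ℤ)).hasSum_iff] at h1
  convert h0.add h1 using 1
  · rfl
  · funext j
    simp only [Function.comp, Equiv.subRight_apply, map_ofReal_add, map_ofReal_mul, smul_add,
      mul_smul_comm, smul_smul]
    rw [← zpow_one_add₀ hz]
    ring_nf
  · simp [linLoop, add_mul]

theorem HasLaurent.entry {c : ℤ → Matrix (Fin 2) (Fin 2) ℝ} {X : Loop} (h : HasLaurent c X)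
    {z : ℂ} (hz : z ≠ 0) (i j : Fin 2) :
    HasSum (fun n : ℤ => z ^ n * (c n i j : ℂ)) (X z i j) := by
  have := Pi.hasSum.1 (Pi.hasSum.1 (h z hz) i) j
  simpa using this

theorem hasLaurent_of_entry {c : ℤ → Matrix (Fin 2) (Fin 2) ℝ} {X : Loop}
    (h : ∀ z ≠ 0, ∀ i j, HasSum (fun n : ℤ => z ^ n * (c n i j : ℂ)) (X z i j)) :
    HasLaurent c X := by
  intro z hz
  refine Pi.hasSum.2 fun i => Pi.hasSum.2 fun j => ?_
  simpa using h z hz i j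

/-- Absolute convergence at the point `‖w‖ + 1` dominates the series on the disc of that radius. -/
theorem exists_entire_of_hasSum {c : ℕ → ℂ} {f : ℂ → ℂ}
    (h : ∀ w ≠ 0, HasSum (fun n => w ^ n * c n) (f w)) :
    ∃ F : ℂ → ℂ, Differentiable ℂ F ∧ F 0 = c 0 ∧ ∀ w ≠ 0, F w = f w := by
  refine ⟨fun w => ∑' n, w ^ n * c n, fun w => ?_, ?_, fun w hw => (h w hw).tsum_eq⟩
  · have hr : ((‖w‖ + 1 : ℝ) : ℂ) ≠ 0 := by
      exact_mod_cast (by positivity : ‖w‖ + 1 ≠ 0)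
    have hd := Complex.differentiableOn_tsum_of_summable_norm (h _ hr).summable.norm
      (F := fun n w => w ^ n * c n) (U := Metric.ball 0 (‖w‖ + 1))
      (fun n => by fun_prop) Metric.isOpen_ball (fun n v hv => ?_)
    · exact hd.differentiableAt (Metric.isOpen_ball.mem_nhds (by simp))
    · have hv' : ‖v‖ ≤ ‖w‖ + 1 := by simpa using (Metric.mem_ball.1 hv).le
      rw [norm_mul, norm_mul, norm_pow, norm_pow, Complex.norm_real,
        Real.norm_of_nonneg (by positivity)]
      gcongr
  · show ∑' n, (0 : ℂ) ^ n * c n = c 0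
    rw [tsum_eq_single 0 fun n hn => by simp [hn]]
    simp

theorem HasLaurent.exists_entire {c : ℤ → Matrix (Fin 2) (Fin 2) ℝ} {X : Loop}
    (h : HasLaurent c X) (hc : ∀ j < 0, c j = 0) (i j : Fin 2) :
    ∃ F : ℂ → ℂ, Differentiable ℂ F ∧ ∀ z ≠ 0, F z = X z i j := by
  obtain ⟨F, hF, -, hFX⟩ := exists_entire_of_hasSum (c := fun n : ℕ => (c n i j : ℂ))
    (f := fun z => X z i j) fun z hz => by
      have := h.entry hz i j
      rw [← Nat.cast_injective.hasSum_iff] at this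
      · simpa [Function.comp_def] using this
      · intro n hn
        have : n < 0 := by
          by_contra hlt
          exact hn ⟨n.toNat, by simpa using hlt⟩
        simp [hc n this]
  exact ⟨F, hF, hFX⟩

theorem HasLaurent.entry_inv {c : ℤ → Matrix (Fin 2) (Fin 2) ℝ} {X : Loop}
    (h : HasLaurent c X) (hc : ∀ j > 0, c j = 0) (i j : Fin 2) {w : ℂ} (hw : w ≠ 0) :
    HasSum (fun n : ℕ => w ^ n * (c (-n) i j : ℂ)) (X w⁻¹ i j) := by
  have := h.entry (inv_ne_zero hw) i j
  have hinj : Function.Injective fun n : ℕ => -(n : ℤ) := neg_injective.comp Nat.cast_injective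
  rw [← hinj.hasSum_iff] at this
  · simpa [Function.comp_def] using this
  · intro n hn
    have : n > 0 := by
      by_contra hlt
      exact hn ⟨n.natAbs, by simp only []; omega⟩
    simp [hc n this]

/-- In the variable `1/z` the entry is entire, so its limit at infinity is its constant term. -/
theorem HasLaurent.tendsto_entry {c : ℤ → Matrix (Fin 2) (Fin 2) ℝ} {X : Loop}
    (h : HasLaurent c X) (hc : ∀ j > 0, c j = 0) (i j : Fin 2) :
    Tendsto (fun z => X z i j) (cocompact ℂ) (𝓝 (c 0 i j : ℂ)) := by
  obtain ⟨F, hF, hF0, hFX⟩ := exists_entire_of_hasSum fun w hw => h.entry_inv hc i j hw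
  have h1 : Tendsto (fun z : ℂ => F z⁻¹) (cocompact ℂ) (𝓝 (F 0)) :=
    (hF.continuous.tendsto 0).comp (by
      rw [← Metric.cobounded_eq_cocompact]; exact tendsto_inv₀_cobounded)
  rw [hF0] at h1
  simp only [Nat.cast_zero, neg_zero] at h1
  refine h1.congr' ?_
  filter_upwards [(isCompact_singleton (x := (0 : ℂ))).compl_mem_cocompact] with z hz
  rw [hFX _ (inv_ne_zero hz), inv_inv]

/-- Dividing the series in `w = 1/z` by `w` leaves a power series whose value at `0` is the
coefficient of `z⁻¹`. -/
theorem HasLaurent.tendsto_mul_entry {c : ℤ → Matrix (Fin 2) (Fin 2) ℝ} {X : Loop}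
    (h : HasLaurent c X) (hc : ∀ j > 0, c j = 0) (i j : Fin 2) (h0 : c 0 i j = 0) :
    Tendsto (fun z => z * X z i j) (cocompact ℂ) (𝓝 (c (-1) i j : ℂ)) := by
  obtain ⟨F, hF, hF0, hFX⟩ := exists_entire_of_hasSum
    (c := fun n => (c (-(n + 1 : ℕ)) i j : ℂ)) (f := fun w => w⁻¹ * X w⁻¹ i j) fun w hw => by
      have := (hasSum_nat_add_iff' 1).2 (h.entry_inv hc i j hw)
      have h2 := this.mul_left w⁻¹
      simp only [Finset.range_one, Finset.sum_singleton, Nat.cast_zero, neg_zero, h0,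
        Complex.ofReal_zero, mul_zero, sub_zero] at h2
      refine h2.congr_fun ?_
      intro n
      rw [pow_succ]
      field_simp
  have h1 : Tendsto (fun z : ℂ => F z⁻¹) (cocompact ℂ) (𝓝 (F 0)) :=
    (hF.continuous.tendsto 0).comp (by
      rw [← Metric.cobounded_eq_cocompact]; exact tendsto_inv₀_cobounded)
  rw [hF0] at h1
  simp only [zero_add, Nat.cast_one] at h1
  refine h1.congr' ?_
  filter_upwards [(isCompact_singleton (x := (0 : ℂ))).compl_mem_cocompact] with z hz
  rw [hFX _ (inv_ne_zero hz), inv_inv]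

/-! ### The decomposition of an upper triangular loop against a loop in `1/z` -/

/-- The loop `1 + z a E₁₂`. -/
def shearLoop (a : ℝ) : Loop := linLoop 1 !![0, a; 0, 0]

/-- The factor `L₊` of the decomposition. -/
def gaugeLoop (a b : ℝ) : Loop := linLoop !![(1 - a * b)⁻¹, 0; 0, 1 - a * b] !![0, a; 0, 0]

theorem shearLoop_apply (a : ℝ) (z : ℂ) : shearLoop a z = !![1, z * a; 0, 1] := by
  ext i j
  fin_cases i <;> fin_cases j <;> simp [shearLoop, linLoop]

theorem gaugeLoop_apply (a b : ℝ) (z : ℂ) :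
    gaugeLoop a b z = !![((1 - a * b)⁻¹ : ℂ), z * a; 0, 1 - a * b] := by
  ext i j
  fin_cases i <;> fin_cases j <;> simp [gaugeLoop, linLoop]

theorem isTwistedUnimodular_shearLoop (a : ℝ) : IsTwistedUnimodular (shearLoop a) := by
  apply isTwistedUnimodular_of_entries <;> simp [shearLoop_apply]

theorem isTwistedUnimodular_gaugeLoop {a b : ℝ} (h : 1 - a * b ≠ 0) :
    IsTwistedUnimodular (gaugeLoop a b) := by
  have h' : (1 - a * b : ℂ) ≠ 0 := by exact_mod_cast h
  apply isTwistedUnimodular_of_entries <;> simp [gaugeLoop_apply, h']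

theorem hasLaurent_linLoop (E₀ E₁ : Matrix (Fin 2) (Fin 2) ℝ) :
    HasLaurent (fun j => (if j = 0 then E₀ else 0) + if j = 1 then E₁ else 0)
      (linLoop E₀ E₁) := by
  have h := (HasLaurent.const 1).mul_linLoop E₀ E₁
  have e : (fun j : ℤ => (if j = 0 then (1 : Matrix (Fin 2) (Fin 2) ℝ) else 0) * E₀ +
      (if j - 1 = 0 then 1 else 0) * E₁) =
      fun j => (if j = 0 then E₀ else 0) + if j = 1 then E₁ else 0 := by
    funext j
    simp [sub_eq_zero]
  rw [e] at h
  exact h.congr fun z _ => by simp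

theorem linLoop_mem_loopPlus {E₀ E₁ : Matrix (Fin 2) (Fin 2) ℝ}
    (h : IsTwistedUnimodular (linLoop E₀ E₁)) : linLoop E₀ E₁ ∈ loopPlus :=
  ⟨h, _, hasLaurent_linLoop E₀ E₁, fun j hj => by
    simp [hj.ne, (hj.trans one_pos).ne]⟩

theorem shearLoop_mem_loopGroup (a : ℝ) : shearLoop a ∈ loopGroup :=
  ⟨isTwistedUnimodular_shearLoop a, _, hasLaurent_linLoop _ _⟩

/-! ### Existence and uniqueness of the splitting. -/

section Birkhoff

variable {a b : ℝ} {X Y : Loop} {c : ℤ → Matrix (Fin 2) (Fin 2) ℝ}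

/-- With `L₊` the gauge loop, `L₋` must be `X⁻¹ Y L₊`, where `X⁻¹` is the shear by `-a`. It remains
to see that its positive powers cancel and its constant term is the identity. -/
theorem isIwasawaFactor_mul_gaugeLoop (hX : ∀ z ≠ 0, X z = shearLoop a z)
    (hY : IsTwistedUnimodular Y) (hc : HasLaurent c Y) (hpos : ∀ j > 0, c j = 0)
    (h0 : c 0 = 1) {p : ℝ} (h1 : c (-1) = !![0, p; b, 0]) (h2 : c (-2) 1 0 = 0)
    (hab : 1 - a * b ≠ 0) : IsIwasawaFactor X Y fun z => Y z * gaugeLoop a b z := by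
  have hk := hc.mul_linLoop !![(1 - a * b)⁻¹, 0; 0, 1 - a * b] !![0, a; 0, 0]
  have hm := hk.linLoop_mul 1 !![0, -a; 0, 0]
  have hG := isTwistedUnimodular_gaugeLoop hab
  have hYG := hY.mul hG
  refine ⟨⟨hYG, _, hk⟩, fun z => shearLoop (-a) z * (Y z * gaugeLoop a b z), ?_,
    gaugeLoop a b, linLoop_mem_loopPlus hG, fun z hz => ?_⟩
  · refine ⟨(isTwistedUnimodular_shearLoop (-a)).mul hYG, _, hm, fun j hj => ?_, ?_⟩
    -- In degree one the upper right entry is `a - a(1-ab) - a²b = 0`; in degree two `E₁₂² = 0`.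
    · obtain rfl | rfl | hj : j = 1 ∨ j = 2 ∨ 2 < j := by omega
      · simp only [sub_self, zero_sub, hpos 1 one_pos, h0, h1]
        ext i j
        fin_cases i <;> fin_cases j <;> simp
        field_simp
        ring
      · norm_num [hpos 1 one_pos, hpos 2 two_pos, h0]
        ext i j
        fin_cases i <;> fin_cases j <;> rfl
      · simp [hpos j (by omega), hpos (j - 1) (by omega), hpos (j - 1 - 1) (by omega)]
    -- The lower left entry of `c (-2)` would contribute `a²` times itself to the upper right
    -- corner; the twist makes it vanish for the actual solution.
    · have h2' : c (-2) = !![c (-2) 0 0, c (-2) 0 1; 0, c (-2) 1 1] := by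
        rw [← h2]; exact Matrix.eta_fin_two _
      norm_num [h0, h1]
      rw [h2']
      ext i j
      fin_cases i <;> fin_cases j <;> simp
      · field_simp
        ring
      · ring
  · have hdG : IsUnit (gaugeLoop a b z).det := by rw [(hG z hz).1]; exact isUnit_one
    have hdM : IsUnit (Y z * gaugeLoop a b z).det := by
      rw [Matrix.det_mul, (hY z hz).1, (hG z hz).1]; simp
    have hs : shearLoop (-a) z * shearLoop a z = 1 := by
      rw [shearLoop_apply, shearLoop_apply]
      ext i j
      fin_cases i <;> fin_cases j <;> simp
    refine ⟨?_, (Matrix.mul_nonsing_inv_cancel_right _ _ hdG).symm⟩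
    rw [hX z hz, Matrix.mul_inv_rev, Matrix.mul_nonsing_inv_cancel_left _ _ hdM]
    exact (Matrix.inv_eq_right_inv hs).symm

theorem eq_const_of_entire_of_tendsto {F f : ℂ → ℂ} (hF : Differentiable ℂ F)
    (hFf : ∀ z ≠ 0, F z = f z) {l : ℂ} (hf : Tendsto f (cocompact ℂ) (𝓝 l)) (z : ℂ) : F z = l := by
  refine hF.apply_eq_of_tendsto_cocompact z (hf.congr' ?_)
  filter_upwards [(isCompact_singleton (x := (0 : ℂ))).compl_mem_cocompact] with z hz
  exact (hFf z hz).symm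

/-- Liouville applied to the difference quotient of `F` at `0`, which is entire and tends to `l` at
infinity. -/
theorem eq_linear_of_entire_of_tendsto {F f : ℂ → ℂ} (hF : Differentiable ℂ F)
    (hFf : ∀ z ≠ 0, F z = z * f z) {l : ℂ} (hf : Tendsto f (cocompact ℂ) (𝓝 l)) (z : ℂ) :
    F z = F 0 + z * l := by
  have hd : Differentiable ℂ (dslope F 0) := by
    rw [← differentiableOn_univ] at hF ⊢
    exact (Complex.differentiableOn_dslope univ_mem).2 hF
  have hF0 : Tendsto (fun z : ℂ => f z - F 0 * z⁻¹) (cocompact ℂ) (𝓝 (l - F 0 * 0)) :=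
    hf.sub ((by rw [← Metric.cobounded_eq_cocompact]; exact tendsto_inv₀_cobounded :
      Tendsto (fun z : ℂ => z⁻¹) (cocompact ℂ) (𝓝 0)).const_mul _)
  have h := eq_const_of_entire_of_tendsto hd (f := fun z => f z - F 0 * z⁻¹) (fun z hz => by
    rw [dslope_of_ne _ hz, slope_def_field, hFf z hz]
    field_simp
    simp
    ring) hF0 z
  rw [mul_zero, sub_zero] at h
  rw [← h]
  have := sub_smul_dslope F 0 z
  simp only [sub_zero, smul_eq_mul] at this
  rw [this]; ring

/-- Each entry of `L₊ = Y⁻¹ X L₋` is entire. At infinity the lower row tends to `(0, 1 - ab)` and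
the upper right entry grows like `z a`, so Liouville fixes these three up to one constant. -/
theorem eq_gaugeLoop_of_isIwasawaFactor {Φ : Loop} (hX : ∀ z ≠ 0, X z = shearLoop a z)
    (hY : IsTwistedUnimodular Y) (hc : HasLaurent c Y) (hpos : ∀ j > 0, c j = 0)
    (h0 : c 0 = 1) (hb : c (-1) 1 0 = b) (h : IsIwasawaFactor X Y Φ) :
    1 - a * b ≠ 0 ∧ ∀ z ≠ 0, Φ z = Y z * gaugeLoop a b z := by
  obtain ⟨-, Lm, ⟨hLm, d, hd, hdpos, hd0⟩, Lp, ⟨hLp, e, he, heneg⟩, hXY⟩ := h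
  have hΦ : ∀ z ≠ 0, Φ z = X z * Lm z ∧ Φ z = Y z * Lp z := fun z hz => by
    have h1 : IsUnit (Lm z).det := by rw [(hLm z hz).1]; exact isUnit_one
    have h2 : IsUnit (Lp z).det := by rw [(hLp z hz).1]; exact isUnit_one
    rw [(hXY z hz).1, (hXY z hz).2, Matrix.nonsing_inv_mul_cancel_right _ _ h1,
      Matrix.nonsing_inv_mul_cancel_right _ _ h2]
    exact ⟨rfl, rfl⟩
  have hLpe : ∀ z ≠ 0, Lp z = (Y z).adjugate * (!![1, z * a; 0, 1] * Lm z) := fun z hz => by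
    rw [← shearLoop_apply, ← hX z hz, ← (hΦ z hz).1, (hΦ z hz).2, ← mul_assoc,
      Matrix.adjugate_mul, (hY z hz).1, one_smul, one_mul]
  have entry : ∀ z ≠ 0,
      Lp z 0 0 = Y z 1 1 * (Lm z 0 0 + a * (z * Lm z 1 0)) - Y z 0 1 * Lm z 1 0 ∧
      Lp z 0 1 = Y z 1 1 * (Lm z 0 1 + z * a * Lm z 1 1) - Y z 0 1 * Lm z 1 1 ∧
      Lp z 1 0 = -Y z 1 0 * (Lm z 0 0 + a * (z * Lm z 1 0)) + Y z 0 0 * Lm z 1 0 ∧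
      Lp z 1 1 = -Y z 1 0 * Lm z 0 1 - a * (z * Y z 1 0) * Lm z 1 1 + Y z 0 0 * Lm z 1 1 := by
    intro z hz
    rw [hLpe z hz, Matrix.adjugate_fin_two]
    simp only [Matrix.mul_apply, Fin.sum_univ_two]
    simp
    refine ⟨?_, ?_, ?_, ?_⟩ <;> first | (left; ring) | ring
  have tY := fun i j => hc.tendsto_entry hpos i j
  have tL := fun i j => hd.tendsto_entry hdpos i j
  have tzY := hc.tendsto_mul_entry hpos 1 0 (by rw [h0]; simp)
  have tzL := hd.tendsto_mul_entry hdpos 1 0 (by rw [hd0]; simp)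
  have tinv : Tendsto (fun z : ℂ => z⁻¹) (cocompact ℂ) (𝓝 0) := by
    rw [← Metric.cobounded_eq_cocompact]; exact tendsto_inv₀_cobounded
  simp only [h0, hd0, Matrix.one_apply, Fin.forall_fin_two] at tY tL
  norm_num at tY tL
  obtain ⟨⟨tY00, tY01⟩, tY10, tY11⟩ := tY
  obtain ⟨⟨tL00, tL01⟩, tL10, tL11⟩ := tL
  rw [hb] at tzY
  obtain ⟨F01, dF01, hF01⟩ := he.exists_entire heneg 0 1
  obtain ⟨F10, dF10, hF10⟩ := he.exists_entire heneg 1 0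
  obtain ⟨F11, dF11, hF11⟩ := he.exists_entire heneg 1 1
  have E10 := eq_const_of_entire_of_tendsto dF10
    (fun z hz => (hF10 z hz).trans (entry z hz).2.2.1)
    ((tY10.neg.mul (tL00.add (tzL.const_mul _))).add (tY00.mul tL10))
  have E11 := eq_const_of_entire_of_tendsto dF11
    (fun z hz => (hF11 z hz).trans (entry z hz).2.2.2)
    (((tY10.neg.mul tL01).sub ((tzY.const_mul _).mul tL11)).add
      (tY00.mul tL11))
  have E01 := eq_linear_of_entire_of_tendsto dF01
    (f := fun z => Y z 1 1 * (z⁻¹ * Lm z 0 1 + a * Lm z 1 1) - z⁻¹ * (Y z 0 1 * Lm z 1 1))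
    (fun z hz => by
      rw [hF01 z hz, (entry z hz).2.1]
      field_simp)
    ((tY11.mul ((tinv.mul tL01).add (tL11.const_mul _))).sub
      (tinv.mul (tY01.mul tL11)))
  simp only [mul_zero, zero_mul, mul_one, one_mul, neg_zero, zero_add, add_zero, zero_sub,
    sub_zero] at E10 E11 E01
  -- The twist makes off-diagonal entries odd, which kills the remaining constant `F01 0`.
  have hodd : F01 (-1) = -F01 1 := by
    rw [hF01 1 one_ne_zero, hF01 (-1) (neg_ne_zero.2 one_ne_zero), ← (hLp 1 one_ne_zero).2,
      matK_conj]
    rfl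
  have hF0 : F01 0 = 0 := by
    have e1 := E01 1
    have e2 := E01 (-1)
    rw [hodd, e1] at e2
    have : 2 * F01 0 = 0 := by linear_combination -e2
    simpa using this
  -- The limit of the upper left entry would involve an unknown coefficient of `L₋`; the determinant
  -- gives the entry instead, and with it `1 - ab ≠ 0`.
  have hdet : ∀ z ≠ 0, Lp z 0 0 * (1 - a * b) = 1 := fun z hz => by
    have := (hLp z hz).1
    rw [Matrix.det_fin_two, ← hF10 z hz, ← hF11 z hz, E10, E11] at this
    linear_combination this
  have hab : (1 - a * b : ℂ) ≠ 0 := right_ne_zero_of_mul_eq_one (hdet 1 one_ne_zero)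
  refine ⟨by exact_mod_cast hab, fun z hz => ?_⟩
  rw [(hΦ z hz).2, gaugeLoop_apply]
  congr 1
  ext i j
  fin_cases i <;> fin_cases j
  · simpa using eq_inv_of_mul_eq_one_left (hdet z hz)
  · show Lp z 0 1 = z * a
    rw [← hF01 z hz, E01, hF0, zero_add]
  · simp [← hF10 z hz, E10]
  · simp [← hF11 z hz, E11]
    ring

end Birkhoff

/-! ### The solution of the second initial value problem -/

/-- The solution of `Ψ' = Ψ z⁻¹ !![0, α; β, 0]`, `Ψ(0) = 1`. -/
def solLoop (α β : ℝ → ℝ) (y : ℝ) : Loop := fun z =>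
  !![rowP α β z⁻¹ y, rowQ α β z⁻¹ y; rowQ β α z⁻¹ y, rowP β α z⁻¹ y]

/-- The Laurent coefficients of `solLoop`. -/
def solCoeff (α β : ℝ → ℝ) (y : ℝ) (j : ℤ) : Matrix (Fin 2) (Fin 2) ℝ :=
  if 0 < j then 0 else
    if Even j then !![iterInt α β j.natAbs y, 0; 0, iterInt β α j.natAbs y]
    else !![0, iterInt α β j.natAbs y; iterInt β α j.natAbs y, 0]

section Sol

variable {α β : ℝ → ℝ} {J : Set ℝ}

theorem solCoeff_pos (y : ℝ) : ∀ j > 0, solCoeff α β y j = 0 := fun j hj => by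
  simp [solCoeff, hj]

theorem solCoeff_zero (y : ℝ) : solCoeff α β y 0 = 1 := by
  simp [solCoeff, Matrix.one_fin_two]

theorem solCoeff_neg_one (y : ℝ) : solCoeff α β y (-1) =
    !![0, iterInt α β 1 y; iterInt β α 1 y, 0] := by
  simp [solCoeff]

theorem solCoeff_neg_two (y : ℝ) : solCoeff α β y (-2) 1 0 = 0 := by
  simp [solCoeff]

variable (hJo : IsOpen J) (hJc : J.OrdConnected) (hJ0 : (0 : ℝ) ∈ J)
  (hα : ContinuousOn α J) (hβ : ContinuousOn β J)
include hJo hJc hJ0 hα hβ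

theorem solvesOffDiag_solLoop (z : ℂ) :
    SolvesOffDiag J (fun y => z⁻¹ * α y) (fun y => z⁻¹ * β y) fun y => solLoop α β y z := by
  rw [solvesOffDiag_iff]
  refine ⟨by simp [solLoop, rowP_zero, rowQ_zero, Matrix.one_fin_two], fun y hy i => ?_⟩
  fin_cases i
  · refine ⟨(hasDerivAt_rowP hJo hJc hJ0 hα hβ hy z⁻¹).congr_deriv ?_,
      (hasDerivAt_rowQ hJo hJc hJ0 hα hβ hy z⁻¹).congr_deriv ?_⟩ <;>
    · simp [solLoop]; ring
  -- The second row starts at `(0, 1)`, so it is the first row's construction with the weights and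
  -- the columns interchanged.
  · refine ⟨(hasDerivAt_rowQ hJo hJc hJ0 hβ hα hy z⁻¹).congr_deriv ?_,
      (hasDerivAt_rowP hJo hJc hJ0 hβ hα hy z⁻¹).congr_deriv ?_⟩ <;>
    · simp [solLoop]; ring

theorem hasLaurent_solLoop {y : ℝ} (hy : y ∈ J) :
    HasLaurent (solCoeff α β y) (solLoop α β y) := by
  refine hasLaurent_of_entry fun z hz i j => ?_
  have hinj : Function.Injective fun n : ℕ => -(n : ℤ) := neg_injective.comp Nat.cast_injective
  rw [← hinj.hasSum_iff]
  · have hp := fun {γ δ : ℝ → ℝ} (hγ : ContinuousOn γ J) (hδ : ContinuousOn δ J) =>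
      (summable_iterInt_smul hJo hJc hJ0 hγ hδ (norm_evenPow_le z⁻¹) hy).hasSum
    have hq := fun {γ δ : ℝ → ℝ} (hγ : ContinuousOn γ J) (hδ : ContinuousOn δ J) =>
      (summable_iterInt_smul hJo hJc hJ0 hγ hδ (norm_oddPow_le z⁻¹) hy).hasSum
    fin_cases i <;> fin_cases j
    · refine (hp hα hβ).congr_fun fun n => ?_
      by_cases hn : Even n <;> simp [solCoeff, evenPow, hn, mul_comm, Int.not_lt.2 (Int.natCast_nonneg n)]
    · refine (hq hα hβ).congr_fun fun n => ?_
      by_cases hn : Even n <;> simp [solCoeff, oddPow, hn, mul_comm, Int.not_lt.2 (Int.natCast_nonneg n)]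
    · refine (hq hβ hα).congr_fun fun n => ?_
      by_cases hn : Even n <;> simp [solCoeff, oddPow, hn, mul_comm, Int.not_lt.2 (Int.natCast_nonneg n)]
    · refine (hp hβ hα).congr_fun fun n => ?_
      by_cases hn : Even n <;> simp [solCoeff, evenPow, hn, mul_comm, Int.not_lt.2 (Int.natCast_nonneg n)]
  · intro n hn
    have : n > 0 := by
      by_contra hlt
      exact hn ⟨n.natAbs, by simp only []; omega⟩
    simp [solCoeff_pos y n this]

omit hJo hJc hJ0 hα hβ in
theorem rowP_neg (w : ℂ) (y : ℝ) : rowP α β (-w) y = rowP α β w y := by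
  refine tsum_congr fun n => ?_
  unfold evenPow; split_ifs with hn
  · simp [hn.neg_pow]
  · rfl

omit hJo hJc hJ0 hα hβ in
theorem rowQ_neg (w : ℂ) (y : ℝ) : rowQ α β (-w) y = -rowQ α β w y := by
  unfold rowQ iterSeries
  rw [← tsum_neg]
  refine tsum_congr fun n => ?_
  unfold oddPow; split_ifs with hn
  · simp
  · simp [(Nat.not_even_iff_odd.1 hn).neg_pow]

theorem isTwistedUnimodular_solLoop {y : ℝ} (hy : y ∈ J) :
    IsTwistedUnimodular (solLoop α β y) := by
  apply isTwistedUnimodular_of_entries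
  · exact fun z _ => (solvesOffDiag_solLoop hJo hJc hJ0 hα hβ z).det_eq_one hJo hJc hJ0 hy
  all_goals
    intro z hz
    simp [solLoop, inv_neg, rowP_neg, rowQ_neg]

end Sol

/-! ### Smoothness and inverse functions on an interval -/

section Smooth

variable {J : Set ℝ}

theorem contDiffOn_infty_of_hasDerivAt {h h' : ℝ → ℝ} (hJo : IsOpen J)
    (hh : ∀ y ∈ J, HasDerivAt h (h' y) y) (hh' : ContDiffOn ℝ ∞ h' J) : ContDiffOn ℝ ∞ h J :=
  (contDiffOn_infty_iff_deriv_of_isOpen hJo).2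
    ⟨fun y hy => (hh y hy).differentiableAt.differentiableWithinAt,
      hh'.congr fun y hy => (hh y hy).deriv⟩

/-- Bootstrapping: each equation gains one derivative over the other unknown. The terms `d₁`, `d₂`
accommodate the system for the parameter derivatives. -/
theorem contDiffOn_of_linear_system {p q c₁ c₂ d₁ d₂ : ℝ → ℝ} (hJo : IsOpen J)
    (hc₁ : ContDiffOn ℝ ∞ c₁ J) (hc₂ : ContDiffOn ℝ ∞ c₂ J)
    (hd₁ : ContDiffOn ℝ ∞ d₁ J) (hd₂ : ContDiffOn ℝ ∞ d₂ J)
    (hp : ∀ y ∈ J, HasDerivAt p (c₁ y * q y + d₁ y) y)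
    (hq : ∀ y ∈ J, HasDerivAt q (c₂ y * p y + d₂ y) y) :
    ContDiffOn ℝ ∞ p J ∧ ContDiffOn ℝ ∞ q J := by
  have key : ∀ n : ℕ, ContDiffOn ℝ n p J ∧ ContDiffOn ℝ n q J := by
    intro n
    induction n with
    | zero =>
      simp only [Nat.cast_zero, contDiffOn_zero]
      exact ⟨fun y hy => (hp y hy).continuousAt.continuousWithinAt,
        fun y hy => (hq y hy).continuousAt.continuousWithinAt⟩
    | succ n ih =>
      have step : ∀ {u v c d : ℝ → ℝ}, ContDiffOn ℝ n v J → ContDiffOn ℝ ∞ c J →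
          ContDiffOn ℝ ∞ d J → (∀ y ∈ J, HasDerivAt u (c y * v y + d y) y) →
          ContDiffOn ℝ ((n + 1 : ℕ) : WithTop ℕ∞) u J := by
        intro u v c d hv hc hd hu
        rw [Nat.cast_add, Nat.cast_one, contDiffOn_succ_iff_deriv_of_isOpen hJo]
        have hn : ((n : ℕ) : WithTop ℕ∞) ≤ ∞ := by exact_mod_cast le_top
        refine ⟨fun y hy => (hu y hy).differentiableAt.differentiableWithinAt, by simp, ?_⟩
        exact (((hc.of_le hn).mul hv).add (hd.of_le hn)).congr fun y hy => (hu y hy).deriv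
      exact ⟨step ih.2 hc₁ hd₁ hp, step ih.1 hc₂ hd₂ hq⟩
  exact ⟨contDiffOn_infty.2 fun n => (key n).1, contDiffOn_infty.2 fun n => (key n).2⟩

theorem injOn_of_hasDerivAt_ne_zero {σ σ' : ℝ → ℝ} (hJc : J.OrdConnected)
    (hσ : ∀ y ∈ J, HasDerivAt σ (σ' y) y) (h0 : ∀ y ∈ J, σ' y ≠ 0) : Set.InjOn σ J := by
  have key : ∀ x ∈ J, ∀ y ∈ J, x < y → σ x ≠ σ y := by
    intro x hx y hy hxy he
    have hsub := hJc.out hx hy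
    obtain ⟨c, hc, hc0⟩ := exists_hasDerivAt_eq_zero hxy
      (fun z hz => (hσ z (hsub hz)).continuousAt.continuousWithinAt) he
      (fun z hz => hσ z (hsub (Set.Ioo_subset_Icc_self hz)))
    exact h0 c (hsub (Set.Ioo_subset_Icc_self hc)) hc0
  intro x hx y hy he
  rcases lt_trichotomy x y with h | h | h
  · exact absurd he (key x hx y hy h)
  · exact h
  · exact absurd he.symm (key y hy x hx h)

/-- A nonvanishing derivative gives injectivity by Rolle and openness by the inverse function
theorem, hence a global smooth inverse. -/
theorem exists_smooth_inverse {σ σ' : ℝ → ℝ} (hJo : IsOpen J) (hJc : J.OrdConnected)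
    (hσ : ∀ y ∈ J, HasDerivAt σ (σ' y) y) (h0 : ∀ y ∈ J, σ' y ≠ 0)
    (hs : ContDiffOn ℝ ∞ σ J) :
    IsOpen (σ '' J) ∧ (σ '' J).OrdConnected ∧ ∃ ρ : ℝ → ℝ, (∀ y ∈ J, ρ (σ y) = y) ∧
      ContDiffOn ℝ ∞ ρ (σ '' J) ∧ ∀ y ∈ J, HasDerivAt ρ (σ' y)⁻¹ (σ y) := by
  have hinj := injOn_of_hasDerivAt_ne_zero hJc hσ h0
  have hat : ∀ y ∈ J, ContDiffAt ℝ ∞ σ y := fun y hy => hs.contDiffAt (hJo.mem_nhds hy)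
  have hopen : IsOpenMap (J.domRestrict σ) := by
    refine IsOpenMap.of_nhds_le fun y => ?_
    have h1 : HasStrictDerivAt σ (σ' y) y :=
      (hat y y.2).hasStrictDerivAt' (hσ y y.2) (by simp)
    have h2 : Filter.map (J.domRestrict σ) (𝓝 y) = 𝓝 (σ y) := by
      rw [← h1.map_nhds_eq (h0 y y.2), ← hJo.isOpenEmbedding_subtypeVal.map_nhds_eq,
        Filter.map_map]
      rfl
    exact h2.ge
  let e : OpenPartialHomeomorph ℝ ℝ := OpenPartialHomeomorph.ofContinuousOpenRestrict
    (hinj.toPartialEquiv σ J) hs.continuousOn hopen hJo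
  have hsymm : ∀ y ∈ J, e.symm (σ y) = y := fun y hy => e.left_inv hy
  have htarget : ∀ y ∈ J, σ y ∈ e.target := fun y hy => Set.mem_image_of_mem σ hy
  refine ⟨e.open_target, (hJc.isPreconnected.image σ hs.continuousOn).ordConnected, e.symm,
    hsymm, ?_, fun y hy => ?_⟩
  · rintro _ ⟨y, hy, rfl⟩
    refine (e.contDiffAt_symm_deriv (h0 y hy) (htarget y hy) ?_ ?_).contDiffWithinAt
    · rw [hsymm y hy]; exact hσ y hy
    · rw [hsymm y hy]; exact hat y hy
  · refine e.hasDerivAt_symm (htarget y hy) (h0 y hy) ?_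
    rw [hsymm y hy]; exact hσ y hy

end Smooth

/-! ### The Lorentzian scalar product -/

theorem lor_comm (u v : E31) : lor u v = lor v u := by simp only [lor]; ring

theorem lor_add_left (u v w : E31) : lor (u + v) w = lor u w + lor v w := by
  simp only [lor, Pi.add_apply]; ring

theorem lor_smul_left (c : ℝ) (u v : E31) : lor (c • u) v = c * lor u v := by
  simp only [lor, Pi.smul_apply, smul_eq_mul]; ring

theorem lor_add_right (u v w : E31) : lor u (v + w) = lor u v + lor u w := by
  simp only [lor, Pi.add_apply]; ring

theorem lor_smul_right (c : ℝ) (u v : E31) : lor u (c • v) = c * lor u v := by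
  simp only [lor, Pi.smul_apply, smul_eq_mul]; ring

/-! ### Surfaces ruled by the null direction of a frame -/

/-- When the first coordinate direction is null for both forms, the entries `G` and `K` drop out of
the mean curvature. -/
theorem half_trace_mul_inv {F G H K : ℝ} (hF : F ≠ 0) :
    1 / 2 * ((!![0, H * F; H * F, K] : Matrix (Fin 2) (Fin 2) ℝ) * (!![0, F; F, G])⁻¹).trace
      = H := by
  have : (!![0, F; F, G] : Matrix (Fin 2) (Fin 2) ℝ)⁻¹ = !![-G / F ^ 2, 1 / F; 1 / F, 0] := by
    refine Matrix.inv_eq_right_inv ?_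
    ext i j
    fin_cases i <;> fin_cases j <;> simp <;> (field_simp; try simp)
  rw [this, Matrix.trace_fin_two]
  simp
  field_simp
  ring

/-- Here `φ_x = q_x B` and `N_x = -H q_x B`. With `F = q_x v` the first form has determinant `-F²`,
and both off-diagonal entries of the second form are `H F`; the curvature `κ` affects only an entry
that does not matter. -/
theorem isTimelikeCMC_of_frame {D : Set (ℝ × ℝ)} {J : Set ℝ} {γ A B C : ℝ → E31}
    {κ v : ℝ → ℝ} {H : ℝ} {q : ℝ × ℝ → ℝ} (hD : IsOpen D)
    (hDJ : ∀ p ∈ D, p.2 ∈ J)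
    (sγ : ContDiffOn ℝ ∞ γ J) (sB : ContDiffOn ℝ ∞ B J) (sC : ContDiffOn ℝ ∞ C J)
    (sq : ContDiffOn ℝ ∞ q D)
    (AA : ∀ y ∈ J, lor (A y) (A y) = 0) (AB : ∀ y ∈ J, lor (A y) (B y) = 1)
    (BB : ∀ y ∈ J, lor (B y) (B y) = 0) (CC : ∀ y ∈ J, lor (C y) (C y) = 1)
    (AC : ∀ y ∈ J, lor (A y) (C y) = 0) (BC : ∀ y ∈ J, lor (B y) (C y) = 0)
    (dγ : ∀ y ∈ J, HasDerivAt γ (v y • A y) y)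
    (dB : ∀ y ∈ J, HasDerivAt B (v y • (H • C y)) y)
    (dC : ∀ y ∈ J, HasDerivAt C (v y • ((-H) • A y + (-κ y) • B y)) y)
    (hv : ∀ y ∈ J, v y ≠ 0) (hq : ∀ p ∈ D, fderiv ℝ q p (1, 0) ≠ 0) :
    IsTimelikeCMC D (fun p => γ p.2 + q p • B p.2) (fun p => C p.2 + (-(H * q p)) • B p.2) H := by
  have comp : ∀ {E : ℝ → E31}, ContDiffOn ℝ ∞ E J → ContDiffOn ℝ ∞ (fun p : ℝ × ℝ => E p.2) D :=
    fun hE => hE.comp contDiffOn_snd hDJ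
  have hqd : ∀ p ∈ D, HasFDerivAt q (fderiv ℝ q p) p := fun p hp =>
    ((sq.contDiffAt (hD.mem_nhds hp)).differentiableAt (by simp)).hasFDerivAt
  have dcomp : ∀ {E : ℝ → E31} {E' : E31} {p : ℝ × ℝ}, HasDerivAt E E' p.2 →
      HasFDerivAt (fun p : ℝ × ℝ => E p.2)
        ((ContinuousLinearMap.toSpanSingleton ℝ E').comp (ContinuousLinearMap.snd ℝ ℝ ℝ)) p :=
    fun hE => hE.hasFDerivAt.comp _ hasFDerivAt_snd
  have hφ : ∀ p ∈ D, pd (fun p => γ p.2 + q p • B p.2) 0 p = fderiv ℝ q p (1, 0) • B p.2 ∧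
      pd (fun p => γ p.2 + q p • B p.2) 1 p =
        v p.2 • A p.2 + ((q p * (v p.2 * H)) • C p.2 + fderiv ℝ q p (0, 1) • B p.2) := by
    intro p hp
    have h := (dcomp (dγ p.2 (hDJ p hp))).add ((hqd p hp).smul (dcomp (dB p.2 (hDJ p hp))))
    unfold pd
    rw [show fderiv ℝ (fun p => γ p.2 + q p • B p.2) p = _ from h.fderiv]
    simp [coordVec, smul_smul]
  have hN : ∀ p ∈ D, pd (fun p => C p.2 + (-(H * q p)) • B p.2) 0 p =
        (-(H * fderiv ℝ q p (1, 0))) • B p.2 ∧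
      pd (fun p => C p.2 + (-(H * q p)) • B p.2) 1 p =
        v p.2 • ((-H) • A p.2 + (-κ p.2) • B p.2) + ((-(H * q p) * (v p.2 * H)) • C p.2 +
          (-(H * fderiv ℝ q p (0, 1))) • B p.2) := by
    intro p hp
    have h := (dcomp (dC p.2 (hDJ p hp))).add
      ((((hqd p hp).const_mul H).neg).smul (dcomp (dB p.2 (hDJ p hp))))
    unfold pd
    rw [show fderiv ℝ (fun p => C p.2 + (-(H * q p)) • B p.2) p = _ from h.fderiv]
    simp [coordVec, smul_smul]
  have hlor : ∀ p ∈ D, lor (A p.2) (A p.2) = 0 ∧ lor (A p.2) (B p.2) = 1 ∧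
      lor (B p.2) (A p.2) = 1 ∧ lor (B p.2) (B p.2) = 0 ∧ lor (C p.2) (C p.2) = 1 ∧
      lor (A p.2) (C p.2) = 0 ∧ lor (C p.2) (A p.2) = 0 ∧ lor (B p.2) (C p.2) = 0 ∧
      lor (C p.2) (B p.2) = 0 := fun p hp => by
    have hy := hDJ p hp
    rw [lor_comm (B p.2) (A p.2), lor_comm (C p.2) (A p.2), lor_comm (C p.2) (B p.2)]
    exact ⟨AA _ hy, AB _ hy, AB _ hy, BB _ hy, CC _ hy, AC _ hy, AC _ hy, BC _ hy, BC _ hy⟩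
  have hI : ∀ p ∈ D, ∃ G, firstForm (fun p => γ p.2 + q p • B p.2) p =
      !![0, fderiv ℝ q p (1, 0) * v p.2; fderiv ℝ q p (1, 0) * v p.2, G] := by
    intro p hp
    refine ⟨firstForm (fun p => γ p.2 + q p • B p.2) p 1 1, ?_⟩
    obtain ⟨-, l₁, l₂, l₃, l₄, l₅, l₆, l₇, l₈⟩ := hlor p hp
    ext i j
    fin_cases i <;> fin_cases j <;>
      simp [firstForm, (hφ p hp).1, (hφ p hp).2, lor_add_left, lor_add_right,
        lor_smul_left, lor_smul_right, l₁, l₂, l₃, l₄, l₅, l₆, l₇, l₈, mul_comm]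
  have hII : ∀ p ∈ D, ∃ K, secondForm (fun p => γ p.2 + q p • B p.2)
      (fun p => C p.2 + (-(H * q p)) • B p.2) p =
      !![0, H * (fderiv ℝ q p (1, 0) * v p.2); H * (fderiv ℝ q p (1, 0) * v p.2), K] := by
    intro p hp
    refine ⟨secondForm (fun p => γ p.2 + q p • B p.2)
      (fun p => C p.2 + (-(H * q p)) • B p.2) p 1 1, ?_⟩
    obtain ⟨-, l₁, l₂, l₃, l₄, l₅, l₆, l₇, l₈⟩ := hlor p hp
    ext i j
    fin_cases i <;> fin_cases j <;>
      simp only [secondForm, Matrix.of_apply, Fin.zero_eta, Fin.mk_one, (hφ p hp).1, (hφ p hp).2,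
        (hN p hp).1, (hN p hp).2, lor_add_left, lor_add_right, lor_smul_left, lor_smul_right,
        l₁, l₂, l₃, l₄, l₅, l₆, l₇, l₈] <;> simp <;> ring
  have hF : ∀ p ∈ D, fderiv ℝ q p (1, 0) * v p.2 ≠ 0 := fun p hp =>
    mul_ne_zero (hq p hp) (hv _ (hDJ p hp))
  refine ⟨(comp sγ).add (sq.smul (comp sB)),
    (comp sC).add ((contDiffOn_const.mul sq).neg.smul (comp sB)), fun p hp => ?_, fun p hp => ?_,
    fun p hp => ?_, fun p hp => ?_⟩
  · obtain ⟨G, hG⟩ := hI p hp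
    rw [hG, Matrix.det_fin_two_of, zero_mul, zero_sub, neg_lt_zero]
    exact mul_self_pos.2 (hF p hp)
  · obtain ⟨-, l₁, l₂, l₃, l₄, l₅, l₆, l₇, l₈⟩ := hlor p hp
    simp only [lor_add_left, lor_add_right, lor_smul_left, lor_smul_right, l₃, l₄, l₇, l₈]
    ring
  · obtain ⟨-, l₁, l₂, l₃, l₄, l₅, l₆, l₇, l₈⟩ := hlor p hp
    rw [Fin.forall_fin_two, (hφ p hp).1, (hφ p hp).2]
    simp only [lor_add_left, lor_add_right, lor_smul_left, lor_smul_right, l₁, l₃, l₄, l₅, l₇, l₈]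
    constructor <;> ring
  · obtain ⟨G, hG⟩ := hI p hp
    obtain ⟨K, hK⟩ := hII p hp
    rw [meanCurvature, hG, hK]
    exact half_trace_mul_inv (hF p hp)

/-- The frame along a curve, reparametrized by arc parameter, is a null Frenet frame. -/
theorem isNullFrenet_of_frame {J : Set ℝ} {γ A B C : ℝ → E31} {κ v σ ρ : ℝ → ℝ} {H : ℝ}
    (hSo : IsOpen (σ '' J)) (hSc : (σ '' J).OrdConnected) (hρ : ∀ y ∈ J, ρ (σ y) = y)
    (sρ : ContDiffOn ℝ ∞ ρ (σ '' J)) (dρ : ∀ y ∈ J, HasDerivAt ρ (v y)⁻¹ (σ y))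
    (sγ : ContDiffOn ℝ ∞ γ J) (sA : ContDiffOn ℝ ∞ A J) (sB : ContDiffOn ℝ ∞ B J)
    (sC : ContDiffOn ℝ ∞ C J)
    (AA : ∀ y ∈ J, lor (A y) (A y) = 0) (AB : ∀ y ∈ J, lor (A y) (B y) = 1)
    (BB : ∀ y ∈ J, lor (B y) (B y) = 0) (CC : ∀ y ∈ J, lor (C y) (C y) = 1)
    (AC : ∀ y ∈ J, lor (A y) (C y) = 0) (BC : ∀ y ∈ J, lor (B y) (C y) = 0)
    (dγ : ∀ y ∈ J, HasDerivAt γ (v y • A y) y)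
    (dA : ∀ y ∈ J, HasDerivAt A (v y • (κ y • C y)) y)
    (dB : ∀ y ∈ J, HasDerivAt B (v y • (H • C y)) y)
    (dC : ∀ y ∈ J, HasDerivAt C (v y • ((-H) • A y + (-κ y) • B y)) y)
    (hv : ∀ y ∈ J, v y ≠ 0) :
    IsNullFrenet (σ '' J) (γ ∘ ρ) (A ∘ ρ) (B ∘ ρ) (C ∘ ρ) (κ ∘ ρ) fun _ => H := by
  have hmaps : Set.MapsTo ρ (σ '' J) J := by
    rintro _ ⟨y, hy, rfl⟩
    rwa [hρ y hy]
  have dcomp : ∀ {E : ℝ → E31} {E' : E31} {y : ℝ}, y ∈ J → HasDerivAt E (v y • E') y →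
      HasDerivAt (E ∘ ρ) E' (σ y) := by
    intro E E' y hy hE
    rw [← hρ y hy] at hE
    refine (hE.scomp (σ y) (dρ y hy)).congr_deriv ?_
    rw [hρ y hy, smul_smul, inv_mul_cancel₀ (hv y hy), one_smul]
  have hval : ∀ y ∈ J, ∀ {X : Type} (E : ℝ → X), (E ∘ ρ) (σ y) = E y := fun y hy X E => by
    rw [Function.comp, hρ y hy]
  refine ⟨hSo, hSc, sγ.comp sρ hmaps, sA.comp sρ hmaps, sB.comp sρ hmaps, sC.comp sρ hmaps,
    ?_, ?_, ?_, ?_, ?_, ?_, ?_, ?_, ?_, ?_⟩ <;> rintro _ ⟨y, hy, rfl⟩ <;> simp only [hval y hy]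
  · exact dcomp hy (dγ y hy)
  · exact AA y hy
  · exact AB y hy
  · exact BB y hy
  · exact CC y hy
  · exact AC y hy
  · exact BC y hy
  · exact dcomp hy (dA y hy)
  · exact dcomp hy (dB y hy)
  · refine (dcomp hy (dC y hy)).congr_deriv ?_
    rw [neg_smul (κ y), ← sub_eq_add_neg]

/-! ### The Sym formula for real frames -/

/-- The vector given by `Ad(M) 𝐤'` for `M = !![P, Q; R, S]` of determinant one. -/
def gaussVec (P Q R S : ℝ) : E31 := ![-(R * S + P * Q), P * Q - R * S, P * S + Q * R]

/-- The vector given by the Sym formula for `M = !![P, Q; R, S]` of determinant one with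
derivative `!![P', Q'; R', S']`. -/
def symVec (H P Q R S P' Q' R' S' : ℝ) : E31 :=
  ![-(1 / H) * ((R' * S - S' * R + P' * Q - Q' * P - (R * S + P * Q)) / 2),
    -(1 / H) * ((R' * S - S' * R - P' * Q + Q' * P + (P * Q - R * S)) / 2),
    -(1 / H) * (S' * P - R' * Q + (P * S + Q * R) / 2)]

theorem inv_of_det_eq_one {P Q R S : ℂ} (h : P * S - Q * R = 1) :
    (!![P, Q; R, S] : Mat2)⁻¹ = !![S, -Q; -R, P] := by
  refine Matrix.inv_eq_right_inv ?_
  ext i j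
  fin_cases i <;> fin_cases j <;> simp
  · linear_combination h
  · ring
  · ring
  · linear_combination h

section Sym

variable {Φ : Loop} {P Q R S : ℝ → ℝ} {t : ℝ}

theorem isGaussPoint_gaussVec {P Q R S : ℝ}
    (hΦ : Φ ((Real.exp t : ℝ) : ℂ) = !![(P : ℂ), (Q : ℂ); (R : ℂ), (S : ℂ)])
    (hdet : P * S - Q * R = 1) : IsGaussPoint Φ t (gaussVec P Q R S) := by
  have h : (P : ℂ) * S - Q * R = 1 := by exact_mod_cast hdet
  rw [IsGaussPoint, hΦ, inv_of_det_eq_one h]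
  ext i j
  fin_cases i <;> fin_cases j <;> simp [toMat, matI, matJ, matK, gaussVec] <;> ring

theorem isSymPoint_symVec {H P' Q' R' S' : ℝ} (hH : H ≠ 0)
    (hΦ : ∀ u : ℝ, Φ ((Real.exp u : ℝ) : ℂ) = !![(P u : ℂ), (Q u : ℂ); (R u : ℂ), (S u : ℂ)])
    (hdet : ∀ u, P u * S u - Q u * R u = 1)
    (hP : HasDerivAt P P' t) (hQ : HasDerivAt Q Q' t) (hR : HasDerivAt R R' t)
    (hS : HasDerivAt S S' t) :
    IsSymPoint H Φ t (symVec H (P t) (Q t) (R t) (S t) P' Q' R' S') := by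
  -- The constant determinant makes the logarithmic derivative trace free. The third coordinate of
  -- `symVec` records only its lower right entry, so the upper left one needs this.
  have htr : P' * S t + P t * S' - (Q' * R t + Q t * R') = 0 := by
    have h1 := (hP.mul hS).sub (hQ.mul hR)
    have h2 : (P * S - Q * R) = fun _ => 1 := funext hdet
    rw [h2] at h1
    exact h1.unique (hasDerivAt_const t 1)
  have htr' : (P' : ℂ) * S t + P t * S' - (Q' * R t + Q t * R') = 0 := by exact_mod_cast htr
  have h : (P t : ℂ) * S t - Q t * R t = 1 := by exact_mod_cast hdet t
  have hHc : (H : ℂ) ≠ 0 := by exact_mod_cast hH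
  refine ⟨!![(P' : ℂ), Q'; R', S'], ?_, ?_⟩
  · simp_rw [hΦ]
    rw [hasDerivAt_mat]
    intro i j
    fin_cases i <;> fin_cases j
    · exact hP.ofReal_comp
    · exact hQ.ofReal_comp
    · exact hR.ofReal_comp
    · exact hS.ofReal_comp
  · rw [hΦ, inv_of_det_eq_one h]
    ext i j
    fin_cases i <;> fin_cases j <;> simp [toMat, matI, matJ, matK, symVec] <;> field_simp
    · linear_combination 2 * htr'
    all_goals first | (left; ring) | ring

end Sym

/-! ### The frame defined by the solution of the second initial value problem -/

/-- The vector given by `Ad(M) E₂₁`, `E₂₁` the lower nilpotent matrix. -/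
def lowerVec (q s : ℝ) : E31 := ![(s ^ 2 + q ^ 2) / 2, (s ^ 2 - q ^ 2) / 2, -(q * s)]

/-- The vector given by `2 Ad(M) E₁₂`, `E₁₂` the upper nilpotent matrix. -/
def upperVec (p r : ℝ) : E31 := ![-(p ^ 2 + r ^ 2), p ^ 2 - r ^ 2, 2 * (p * r)]

section Algebra

variable {p q r s : ℝ}

theorem lor_lowerVec_lowerVec : lor (lowerVec q s) (lowerVec q s) = 0 := by
  simp [lor, lowerVec]; ring

theorem lor_upperVec_upperVec : lor (upperVec p r) (upperVec p r) = 0 := by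
  simp [lor, upperVec]; ring

/-- The product is the square of the determinant; the factor 2 in `upperVec` is chosen for this
normalization. -/
theorem lor_lowerVec_upperVec (h : p * s - q * r = 1) :
    lor (lowerVec q s) (upperVec p r) = 1 := by
  simp [lor, upperVec, lowerVec]
  linear_combination (p * s - q * r + 1) * h

theorem lor_gaussVec_gaussVec (h : p * s - q * r = 1) :
    lor (gaussVec p q r s) (gaussVec p q r s) = 1 := by
  simp [lor, gaussVec]
  linear_combination (p * s - q * r + 1) * h

theorem lor_lowerVec_gaussVec : lor (lowerVec q s) (gaussVec p q r s) = 0 := by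
  simp [lor, lowerVec, gaussVec]; ring

theorem lor_upperVec_gaussVec : lor (upperVec p r) (gaussVec p q r s) = 0 := by
  simp [lor, upperVec, gaussVec]; ring

/-- Conjugating `𝐤'` by the upper triangular `L₊` adds only a multiple of `E₁₂`. -/
theorem gaussVec_gauge {z a b : ℝ} (hab : 1 - a * b ≠ 0) :
    gaussVec (p * (1 - a * b)⁻¹) (p * (z * a) + q * (1 - a * b)) (r * (1 - a * b)⁻¹)
      (r * (z * a) + s * (1 - a * b)) =
      gaussVec p q r s + (z * (a / (1 - a * b))) • upperVec p r := by
  ext i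
  fin_cases i <;> simp [gaussVec, upperVec] <;> field_simp <;> ring

/-- Both `∂ₜL₊ L₊⁻¹` and half the change of `Ad(L₊) 𝐤'` equal `z a/(1-ab) E₁₂`. Their sum explains
the coefficient, since `upperVec` carries a factor 2. The derivative slots reflect `∂ₜ(z a) = z a`
for `z = eᵗ`. -/
theorem symVec_gauge {H z a b p' q' r' s' : ℝ} (hH : H ≠ 0)
    (hab : 1 - a * b ≠ 0) :
    symVec H (p * (1 - a * b)⁻¹) (p * (z * a) + q * (1 - a * b)) (r * (1 - a * b)⁻¹)
      (r * (z * a) + s * (1 - a * b)) (p' * (1 - a * b)⁻¹)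
      (p' * (z * a) + p * (z * a) + q' * (1 - a * b)) (r' * (1 - a * b)⁻¹)
      (r' * (z * a) + r * (z * a) + s' * (1 - a * b)) =
      symVec H p q r s p' q' r' s' + (-(z / H) * (a / (1 - a * b))) • upperVec p r := by
  ext i
  fin_cases i <;> simp [symVec, upperVec] <;> field_simp <;> ring

end Algebra

section Frame

variable {p q r s pt qt rt st : ℝ → ℝ} {H w y α g : ℝ}

theorem hasDerivAt_lowerVec (hg : g ≠ 0) (hq : HasDerivAt q (w * α * p y) y)
    (hs : HasDerivAt s (w * α * r y) y) :
    HasDerivAt (fun y => lowerVec (q y) (s y))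
      ((w * g) • ((-α / g) • gaussVec (p y) (q y) (r y) (s y))) y := by
  refine hasDerivAt_pi.2 fun i => ?_
  fin_cases i
  · refine (((hs.pow 2).add (hq.pow 2)).div_const 2).congr_deriv ?_
    simp [gaussVec]; field_simp; ring
  · refine (((hs.pow 2).sub (hq.pow 2)).div_const 2).congr_deriv ?_
    simp [gaussVec]; field_simp; ring
  · refine (hq.mul hs).neg.congr_deriv ?_
    simp [gaussVec]; field_simp; ring

theorem hasDerivAt_upperVec (hp : HasDerivAt p (w * (H / 2 * g) * q y) y)
    (hr : HasDerivAt r (w * (H / 2 * g) * s y) y) :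
    HasDerivAt (fun y => upperVec (p y) (r y))
      ((w * g) • (H • gaussVec (p y) (q y) (r y) (s y))) y := by
  refine hasDerivAt_pi.2 fun i => ?_
  fin_cases i
  · refine ((hp.pow 2).add (hr.pow 2)).neg.congr_deriv ?_
    simp [gaussVec]; ring
  · refine ((hp.pow 2).sub (hr.pow 2)).congr_deriv ?_
    simp [gaussVec]; ring
  · refine ((hp.mul hr).const_mul 2).congr_deriv ?_
    simp [gaussVec]; ring

theorem hasDerivAt_gaussVec (hg : g ≠ 0) (hp : HasDerivAt p (w * (H / 2 * g) * q y) y)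
    (hq : HasDerivAt q (w * α * p y) y) (hr : HasDerivAt r (w * (H / 2 * g) * s y) y)
    (hs : HasDerivAt s (w * α * r y) y) :
    HasDerivAt (fun y => gaussVec (p y) (q y) (r y) (s y))
      ((w * g) • ((-H) • lowerVec (q y) (s y) + (-(-α / g)) • upperVec (p y) (r y))) y := by
  refine hasDerivAt_pi.2 fun i => ?_
  fin_cases i
  · refine ((hr.mul hs).add (hp.mul hq)).neg.congr_deriv ?_
    simp [lowerVec, upperVec]; field_simp; ring
  · refine ((hp.mul hq).sub (hr.mul hs)).congr_deriv ?_
    simp [lowerVec, upperVec]; field_simp; ring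
  · refine ((hp.mul hs).add (hq.mul hr)).congr_deriv ?_
    simp [lowerVec, upperVec]; field_simp; ring

/-- The derivative is `-(1/H) Ad(Φ₋)(∂ₜξ + ½[ξ, 𝐤'])` with `∂ₜξ = -ξ`. The upper right parts cancel
and the lower left parts add, so only `E₂₁` survives and `α` disappears. -/
theorem hasDerivAt_symVec (hH : H ≠ 0) (hp : HasDerivAt p (w * (H / 2 * g) * q y) y)
    (hq : HasDerivAt q (w * α * p y) y) (hr : HasDerivAt r (w * (H / 2 * g) * s y) y)
    (hs : HasDerivAt s (w * α * r y) y) (hpt : HasDerivAt pt (w * (H / 2 * g) * (qt y - q y)) y)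
    (hqt : HasDerivAt qt (w * α * (pt y - p y)) y)
    (hrt : HasDerivAt rt (w * (H / 2 * g) * (st y - s y)) y)
    (hst : HasDerivAt st (w * α * (rt y - r y)) y) :
    HasDerivAt (fun y => symVec H (p y) (q y) (r y) (s y) (pt y) (qt y) (rt y) (st y))
      ((w * g) • lowerVec (q y) (s y)) y := by
  refine hasDerivAt_pi.2 fun i => ?_
  fin_cases i
  · refine (((((((hrt.mul hs).sub (hst.mul hr)).add (hpt.mul hq)).sub (hqt.mul hp)).sub
      ((hr.mul hs).add (hp.mul hq))).div_const 2).const_mul (-(1 / H))).congr_deriv ?_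
    simp [lowerVec]; field_simp; ring
  · refine (((((((hrt.mul hs).sub (hst.mul hr)).sub (hpt.mul hq)).add (hqt.mul hp)).add
      ((hp.mul hq).sub (hr.mul hs))).div_const 2).const_mul (-(1 / H))).congr_deriv ?_
    simp [lowerVec]; field_simp; ring
  · refine (((((hst.mul hp).sub (hrt.mul hq))).add
      (((hp.mul hs).add (hq.mul hr)).div_const 2)).const_mul (-(1 / H))).congr_deriv ?_
    simp [lowerVec]; field_simp; ring

end Frame

/-! ### The two initial value problems -/

theorem solvesIVP_iff {I : Set ℝ} {ξ Ψ : ℝ → Loop} {A B : ℂ → ℝ → ℂ}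
    (h : ∀ z x, ξ x z = !![0, A z x; B z x, 0]) :
    SolvesIVP I ξ Ψ ↔ ∀ z ≠ 0, SolvesOffDiag I (A z) (B z) fun x => Ψ x z := by
  simp only [SolvesIVP, SolvesOffDiag, h]

theorem xiPrime_zero_apply (H : ℝ) (f : ℝ → ℝ) (z : ℂ) (x : ℝ) :
    xiPrime H (fun _ => 0) f x z = !![0, z * ((-(H / 2) * f x : ℝ) : ℂ); 0, 0] := by
  ext i j
  fin_cases i <;> fin_cases j <;> simp [xiPrime]

theorem xiSecond_apply (H : ℝ) (R g : ℝ → ℝ) (z : ℂ) (y : ℝ) :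
    xiSecond H R g y z =
      !![0, z⁻¹ * ((-(R y / g y) : ℝ) : ℂ); z⁻¹ * ((H / 2 * g y : ℝ) : ℂ), 0] := by
  ext i j
  fin_cases i <;> fin_cases j <;> simp [xiSecond]

theorem solvesOffDiag_shearLoop {I : Set ℝ} {a a' : ℝ → ℝ} (h0 : a 0 = 0)
    (ha : ∀ x ∈ I, HasDerivAt a (a' x) x) (z : ℂ) :
    SolvesOffDiag I (fun x => z * a' x) (fun _ => 0) fun x => shearLoop (a x) z := by
  simp only [shearLoop_apply]
  rw [solvesOffDiag_iff]
  refine ⟨by simp [h0, Matrix.one_fin_two], fun x hx i => ?_⟩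
  fin_cases i
  · exact ⟨(hasDerivAt_const x (1 : ℂ)).congr_deriv (by simp),
      ((ha x hx).ofReal_comp.const_mul z).congr_deriv (by simp)⟩
  · exact ⟨(hasDerivAt_const x (0 : ℂ)).congr_deriv (by simp),
      (hasDerivAt_const x (1 : ℂ)).congr_deriv (by simp)⟩

theorem solLoop_exp {α β : ℝ → ℝ} (y u : ℝ) : solLoop α β y ((Real.exp u : ℝ) : ℂ) =
    !![((rowP α β (Real.exp (-u)) y : ℝ) : ℂ), ((rowQ α β (Real.exp (-u)) y : ℝ) : ℂ);
      ((rowQ β α (Real.exp (-u)) y : ℝ) : ℂ), ((rowP β α (Real.exp (-u)) y : ℝ) : ℂ)] := by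
  rw [solLoop, ← Complex.ofReal_inv, ← Real.exp_neg]
  simp only [rowP_ofReal, rowQ_ofReal]

theorem rows_det_eq_one {α β : ℝ → ℝ} {J : Set ℝ} (hJo : IsOpen J) (hJc : J.OrdConnected)
    (hJ0 : (0 : ℝ) ∈ J) (hα : ContinuousOn α J) (hβ : ContinuousOn β J) {y : ℝ} (hy : y ∈ J)
    (u : ℝ) : rowP α β (Real.exp (-u)) y * rowP β α (Real.exp (-u)) y -
      rowQ α β (Real.exp (-u)) y * rowQ β α (Real.exp (-u)) y = 1 := by
  have h := (solvesOffDiag_solLoop hJo hJc hJ0 hα hβ ((Real.exp u : ℝ) : ℂ)).det_eq_one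
    hJo hJc hJ0 hy
  rw [solLoop_exp, Matrix.det_fin_two_of] at h
  exact_mod_cast h

theorem hasDerivAt_exp_neg (t : ℝ) :
    HasDerivAt (fun u => Real.exp (-u)) (-Real.exp (-t)) t := by
  simpa using (hasDerivAt_neg t).exp

/-! ### The big cell, the scroll coordinates and the assembled surface. -/

section Scroll

variable {I J : Set ℝ} (hIo : IsOpen I) (hIc : I.OrdConnected)
  (hJo : IsOpen J) (hJc : J.OrdConnected) (hJ0 : (0 : ℝ) ∈ J)

include hJo hJc hJ0 in
/-- The set of points where the pair of solutions decomposes, and the factor there. -/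
theorem mem_bigCell_iff {Ψp Ψs : ℝ → Loop} {a α β : ℝ → ℝ}
    (hp : ∀ x ∈ I, ∀ z ≠ 0, Ψp x z = shearLoop (a x) z)
    (hα : ContinuousOn α J) (hβ : ContinuousOn β J)
    (hs : ∀ y ∈ J, ∀ z ≠ 0, Ψs y z = solLoop α β y z) (x : ℝ × ℝ) :
    (x ∈ bigCell I J Ψp Ψs ↔ x ∈ I ×ˢ J ∧ 1 - a x.1 * iterInt β α 1 x.2 ≠ 0) ∧
      ∀ Φ, x ∈ I ×ˢ J → IsIwasawaFactor (Ψp x.1) (Ψs x.2) Φ →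
        ∀ z ≠ 0, Φ z = solLoop α β x.2 z * gaugeLoop (a x.1) (iterInt β α 1 x.2) z := by
  have key : ∀ Φ, x ∈ I ×ˢ J → IsIwasawaFactor (Ψp x.1) (Ψs x.2) Φ →
      1 - a x.1 * iterInt β α 1 x.2 ≠ 0 ∧
      ∀ z ≠ 0, Φ z = solLoop α β x.2 z * gaugeLoop (a x.1) (iterInt β α 1 x.2) z := by
    intro Φ hx ⟨hΦ, Lm, hLm, Lp, hLp, h⟩
    exact eq_gaugeLoop_of_isIwasawaFactor (Y := solLoop α β x.2) (hp x.1 hx.1)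
      (isTwistedUnimodular_solLoop hJo hJc hJ0 hα hβ hx.2)
      (hasLaurent_solLoop hJo hJc hJ0 hα hβ hx.2) (solCoeff_pos _) (solCoeff_zero _)
      (by simp [solCoeff_neg_one])
      ⟨hΦ, Lm, hLm, Lp, hLp, fun z hz => ⟨(h z hz).1, (hs x.2 hx.2 z hz).symm.trans (h z hz).2⟩⟩
  refine ⟨⟨fun ⟨hx, Φ, hΦ⟩ => ⟨hx, (key Φ hx hΦ).1⟩, fun ⟨hx, hab⟩ => ⟨hx, fun z =>
      solLoop α β x.2 z * gaugeLoop (a x.1) (iterInt β α 1 x.2) z, ?_⟩⟩,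
    fun Φ hx hΦ => (key Φ hx hΦ).2⟩
  obtain ⟨h1, Lm, hLm, Lp, hLp, h⟩ := isIwasawaFactor_mul_gaugeLoop (Y := solLoop α β x.2)
    (hp x.1 hx.1) (isTwistedUnimodular_solLoop hJo hJc hJ0 hα hβ hx.2)
    (hasLaurent_solLoop hJo hJc hJ0 hα hβ hx.2) (solCoeff_pos _) (solCoeff_zero _)
    (solCoeff_neg_one _) (solCoeff_neg_two _) hab
  exact ⟨h1, Lm, hLm, Lp, hLp, fun z hz => ⟨(h z hz).1, (hs x.2 hx.2 z hz).trans (h z hz).2⟩⟩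

include hIc hJc in
-- For fixed `y` the ruling parameter is a Möbius function of `a(x)`, hence injective on the entire
-- slice of `D`, even if that slice is disconnected.
theorem isScrollParam_of_fractional {D : Set (ℝ × ℝ)} {a a' b σ σ' : ℝ → ℝ} {c : ℝ}
    (hDo : IsOpen D) (hD : ∀ p ∈ D, p ∈ I ×ˢ J ∧ 1 - a p.1 * b p.2 ≠ 0)
    (ha : ∀ x ∈ I, HasDerivAt a (a' x) x) (ha0 : ∀ x ∈ I, a' x ≠ 0)
    (hσ : ∀ y ∈ J, HasDerivAt σ (σ' y) y) (hσ0 : ∀ y ∈ J, σ' y ≠ 0)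
    (sa : ContDiffOn ℝ ∞ a I) (sb : ContDiffOn ℝ ∞ b J) (sσ : ContDiffOn ℝ ∞ σ J) (hc : c ≠ 0) :
    IsScrollParam D J σ fun p => c * (a p.1 / (1 - a p.1 * b p.2)) := by
  have sa' : ContDiffOn ℝ ∞ (fun p : ℝ × ℝ => a p.1) D :=
    sa.comp contDiffOn_fst fun p hp => (hD p hp).1.1
  have sb' : ContDiffOn ℝ ∞ (fun p : ℝ × ℝ => b p.2) D :=
    sb.comp contDiffOn_snd fun p hp => (hD p hp).1.2
  have sq : ContDiffOn ℝ ∞ (fun p : ℝ × ℝ => c * (a p.1 / (1 - a p.1 * b p.2))) D :=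
    contDiffOn_const.mul (sa'.div (contDiffOn_const.sub (sa'.mul sb')) fun p hp => (hD p hp).2)
  refine ⟨sσ, sq, fun y hy => ?_, fun p hp => ?_, ?_⟩
  · rw [(hσ y hy).deriv]; exact hσ0 y hy
  · have hd := ((sq.contDiffAt (hDo.mem_nhds hp)).differentiableAt (by simp)).hasFDerivAt
    have hl : HasDerivAt (fun x : ℝ => (x, p.2)) ((1 : ℝ), (0 : ℝ)) p.1 :=
      (hasDerivAt_id p.1).prodMk (hasDerivAt_const p.1 p.2)
    have h1 := HasFDerivAt.comp_hasDerivAt p.1 (f := fun x : ℝ => (x, p.2)) hd hl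
    have hax := ha p.1 (hD p hp).1.1
    have h2 := (hax.div ((hasDerivAt_const p.1 (1 : ℝ)).sub (hax.mul_const (b p.2)))
      (hD p hp).2).const_mul c
    rw [h1.unique h2]
    refine mul_ne_zero hc (div_ne_zero ?_ (pow_ne_zero 2 (hD p hp).2))
    -- The numerator of the quotient rule collapses to `a'`.
    simp only [Pi.sub_apply]
    ring_nf
    exact ha0 p.1 (hD p hp).1.1
  · rintro ⟨x, y⟩ hp ⟨x', y'⟩ hp' he
    obtain ⟨⟨hx, hy⟩, h1⟩ := hD _ hp
    obtain ⟨⟨hx', hy'⟩, h2⟩ := hD _ hp'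
    simp only [Prod.mk.injEq] at he hx hy hx' hy' h1 h2
    obtain rfl := injOn_of_hasDerivAt_ne_zero hJc hσ hσ0 hy hy' he.1
    have h3 := mul_left_cancel₀ hc he.2
    rw [div_eq_div_iff h1 h2] at h3
    have h4 : a x = a x' := by linear_combination h3
    rw [injOn_of_hasDerivAt_ne_zero hIc ha ha0 hx hx' h4]

include hIo hIc hJo hJc hJ0 in
theorem exists_scroll {H : ℝ} (hH : H ≠ 0) {f g α β : ℝ → ℝ} {D : Set (ℝ × ℝ)}
    (hf : ContDiffOn ℝ ∞ f I) (hg : ContDiffOn ℝ ∞ g J) (hα : ContDiffOn ℝ ∞ α J)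
    (hβ : ContDiffOn ℝ ∞ β J) (hf0 : ∀ x ∈ I, f x ≠ 0) (hg0 : ∀ y ∈ J, g y ≠ 0)
    (hβg : ∀ y, β y = H / 2 * g y) {a : ℝ → ℝ}
    (ha : ∀ x ∈ I, HasDerivAt a (-(H / 2) * f x) x) (hDo : IsOpen D)
    (hD : ∀ p ∈ D, p ∈ I ×ˢ J ∧ 1 - a p.1 * iterInt β α 1 p.2 ≠ 0)
    {Ψs : ℝ → Loop} (hs : ∀ y ∈ J, ∀ z ≠ 0, Ψs y z = solLoop α β y z) {Φ : ℝ × ℝ → Loop}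
    (hΦ : ∀ p ∈ D, ∀ z ≠ 0, Φ p z =
      solLoop α β p.2 z * gaugeLoop (a p.1) (iterInt β α 1 p.2) z) (t : ℝ) :
    ∃ φ N : ℝ × ℝ → E31, (∀ p ∈ D, IsSymPoint H (Φ p) t (φ p) ∧ IsGaussPoint (Φ p) t (N p)) ∧
      IsTimelikeCMC D φ N H ∧
      ∃ (γ A B C : ℝ → E31) (κ σ : ℝ → ℝ) (q : ℝ × ℝ → ℝ),
        IsNullFrenet (σ '' J) γ A B C κ (fun _ => H) ∧
        (∀ y ∈ J, IsSymPoint H (Ψs y) t (γ (σ y))) ∧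
        IsScrollParam D J σ q ∧ ∀ p ∈ D, φ p = bScroll γ B (σ p.2, q p) := by
  have cα := hα.continuousOn
  have cβ := hβ.continuousOn
  set w := Real.exp (-t) with hw
  have hw0 : w ≠ 0 := (Real.exp_pos _).ne'
  set p : ℝ → ℝ := rowP α β w with hp
  set q : ℝ → ℝ := rowQ α β w with hq
  set r : ℝ → ℝ := rowQ β α w with hr
  set s : ℝ → ℝ := rowP β α w with hs'
  -- These are the `t`-derivatives of the entries: since `w = e⁻ᵗ`, `d/dt = -w d/dw`.
  set pt : ℝ → ℝ := fun y => -w * rowP' α β w y with hpt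
  set qt : ℝ → ℝ := fun y => -w * rowQ' α β w y with hqt
  set rt : ℝ → ℝ := fun y => -w * rowQ' β α w y with hrt
  set st : ℝ → ℝ := fun y => -w * rowP' β α w y with hst
  have det : ∀ y ∈ J, p y * s y - q y * r y = 1 := fun y hy =>
    rows_det_eq_one hJo hJc hJ0 cα cβ hy t
  have dp : ∀ y ∈ J, HasDerivAt p (w * (H / 2 * g y) * q y) y := fun y hy =>
    (hasDerivAt_rowP hJo hJc hJ0 cα cβ hy w).congr_deriv (by simp [hβg, hq]; ring)
  have dq : ∀ y ∈ J, HasDerivAt q (w * α y * p y) y := fun y hy =>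
    (hasDerivAt_rowQ hJo hJc hJ0 cα cβ hy w).congr_deriv (by simp [hp]; ring)
  have dr : ∀ y ∈ J, HasDerivAt r (w * (H / 2 * g y) * s y) y := fun y hy =>
    (hasDerivAt_rowQ hJo hJc hJ0 cβ cα hy w).congr_deriv (by simp [hβg, hs']; ring)
  have ds : ∀ y ∈ J, HasDerivAt s (w * α y * r y) y := fun y hy =>
    (hasDerivAt_rowP hJo hJc hJ0 cβ cα hy w).congr_deriv (by simp [hr]; ring)
  have dpt : ∀ y ∈ J, HasDerivAt pt (w * (H / 2 * g y) * (qt y - q y)) y := fun y hy =>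
    ((hasDerivAt_rowP' hJo hJc hJ0 cα cβ hy w).const_mul (-w)).congr_deriv
      (by simp [hβg, hq, hqt]; ring)
  have dqt : ∀ y ∈ J, HasDerivAt qt (w * α y * (pt y - p y)) y := fun y hy =>
    ((hasDerivAt_rowQ' hJo hJc hJ0 cα cβ hy w).const_mul (-w)).congr_deriv
      (by simp [hp, hpt]; ring)
  have drt : ∀ y ∈ J, HasDerivAt rt (w * (H / 2 * g y) * (st y - s y)) y := fun y hy =>
    ((hasDerivAt_rowQ' hJo hJc hJ0 cβ cα hy w).const_mul (-w)).congr_deriv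
      (by simp [hβg, hs', hst]; ring)
  have dst : ∀ y ∈ J, HasDerivAt st (w * α y * (rt y - r y)) y := fun y hy =>
    ((hasDerivAt_rowP' hJo hJc hJ0 cβ cα hy w).const_mul (-w)).congr_deriv
      (by simp [hr, hrt]; ring)
  have swα : ContDiffOn ℝ ∞ (fun y => w * α y) J := contDiffOn_const.mul hα
  have swg : ContDiffOn ℝ ∞ (fun y => w * (H / 2 * g y)) J :=
    contDiffOn_const.mul (contDiffOn_const.mul hg)
  have s0 : ContDiffOn ℝ ∞ (fun _ : ℝ => (0 : ℝ)) J := contDiffOn_const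
  obtain ⟨sp, sq⟩ := contDiffOn_of_linear_system hJo swg swα s0 s0
    (fun y hy => (dp y hy).congr_deriv (by ring)) (fun y hy => (dq y hy).congr_deriv (by ring))
  obtain ⟨sr, ss⟩ := contDiffOn_of_linear_system hJo swg swα s0 s0
    (fun y hy => (dr y hy).congr_deriv (by ring)) (fun y hy => (ds y hy).congr_deriv (by ring))
  obtain ⟨spt, sqt⟩ := contDiffOn_of_linear_system hJo swg swα (swg.mul sq).neg (swα.mul sp).neg
    (fun y hy => (dpt y hy).congr_deriv (by ring))
    (fun y hy => (dqt y hy).congr_deriv (by ring))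
  obtain ⟨srt, sst⟩ := contDiffOn_of_linear_system hJo swg swα (swg.mul ss).neg (swα.mul sr).neg
    (fun y hy => (drt y hy).congr_deriv (by ring))
    (fun y hy => (dst y hy).congr_deriv (by ring))
  set γ : ℝ → E31 := fun y => symVec H (p y) (q y) (r y) (s y) (pt y) (qt y) (rt y) (st y)
  set A : ℝ → E31 := fun y => lowerVec (q y) (s y)
  set B : ℝ → E31 := fun y => upperVec (p y) (r y)
  set C : ℝ → E31 := fun y => gaussVec (p y) (q y) (r y) (s y)
  have dγ : ∀ y ∈ J, HasDerivAt γ ((w * g y) • A y) y := fun y hy =>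
    hasDerivAt_symVec hH (dp y hy) (dq y hy) (dr y hy) (ds y hy) (dpt y hy) (dqt y hy)
      (drt y hy) (dst y hy)
  have dA : ∀ y ∈ J, HasDerivAt A ((w * g y) • ((-α y / g y) • C y)) y := fun y hy =>
    hasDerivAt_lowerVec (hg0 y hy) (dq y hy) (ds y hy)
  have dB : ∀ y ∈ J, HasDerivAt B ((w * g y) • (H • C y)) y := fun y hy =>
    hasDerivAt_upperVec (dp y hy) (dr y hy)
  have dC : ∀ y ∈ J, HasDerivAt C ((w * g y) • ((-H) • A y + (-(-α y / g y)) • B y)) y :=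
    fun y hy => hasDerivAt_gaussVec (hg0 y hy) (dp y hy) (dq y hy) (dr y hy) (ds y hy)
  have sA : ContDiffOn ℝ ∞ A J := contDiffOn_pi.2 fun i => by
    fin_cases i
    · exact ((ss.pow 2).add (sq.pow 2)).div_const 2
    · exact ((ss.pow 2).sub (sq.pow 2)).div_const 2
    · exact (sq.mul ss).neg
  have sB : ContDiffOn ℝ ∞ B J := contDiffOn_pi.2 fun i => by
    fin_cases i
    · exact ((sp.pow 2).add (sr.pow 2)).neg
    · exact (sp.pow 2).sub (sr.pow 2)
    · exact contDiffOn_const.mul (sp.mul sr)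
  have sC : ContDiffOn ℝ ∞ C J := contDiffOn_pi.2 fun i => by
    fin_cases i
    · exact ((sr.mul ss).add (sp.mul sq)).neg
    · exact (sp.mul sq).sub (sr.mul ss)
    · exact (sp.mul ss).add (sq.mul sr)
  have sγ : ContDiffOn ℝ ∞ γ J := contDiffOn_pi.2 fun i => by
    fin_cases i
    · exact contDiffOn_const.mul ((((((srt.mul ss).sub (sst.mul sr)).add (spt.mul sq)).sub
        (sqt.mul sp)).sub ((sr.mul ss).add (sp.mul sq))).div_const 2)
    · exact contDiffOn_const.mul ((((((srt.mul ss).sub (sst.mul sr)).sub (spt.mul sq)).add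
        (sqt.mul sp)).add ((sp.mul sq).sub (sr.mul ss))).div_const 2)
    · exact contDiffOn_const.mul (((sst.mul sp).sub (srt.mul sq)).add
        (((sp.mul ss).add (sq.mul sr)).div_const 2))
  have hv : ∀ y ∈ J, w * g y ≠ 0 := fun y hy => mul_ne_zero hw0 (hg0 y hy)
  -- Integrating the speed `w g` yields the parameter in which `γ' = A`.
  set σ : ℝ → ℝ := fun y => w * ∫ x in (0 : ℝ)..y, g x
  have dσ : ∀ y ∈ J, HasDerivAt σ (w * g y) y := fun y hy =>
    (hasDerivAt_integral_of_continuousOn hJo hJc hJ0 hg.continuousOn hy).const_mul w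
  have sσ : ContDiffOn ℝ ∞ σ J := contDiffOn_infty_of_hasDerivAt hJo dσ (contDiffOn_const.mul hg)
  have sa : ContDiffOn ℝ ∞ a I := contDiffOn_infty_of_hasDerivAt hIo ha (contDiffOn_const.mul hf)
  have sb : ContDiffOn ℝ ∞ (iterInt β α 1) J := contDiffOn_infty_of_hasDerivAt hJo
    (fun y hy => (hasDerivAt_iterInt_succ hJo hJc hJ0 cβ cα 0 hy).congr_deriv
      (by simp [alt] : _ = β y)) hβ
  have hpar : IsScrollParam D J σ fun p => -(Real.exp t / H) *
      (a p.1 / (1 - a p.1 * iterInt β α 1 p.2)) :=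
    isScrollParam_of_fractional hIc hJc hDo hD ha
      (fun x hx => mul_ne_zero (by simpa using hH) (hf0 x hx)) dσ hv sa sb sσ
      (neg_ne_zero.2 (div_ne_zero (Real.exp_pos t).ne' hH))
  set Q : ℝ × ℝ → ℝ := fun p => -(Real.exp t / H) * (a p.1 / (1 - a p.1 * iterInt β α 1 p.2))
  obtain ⟨hSo, hSc, ρ, hρ, sρ, dρ⟩ := exists_smooth_inverse hJo hJc dσ hv sσ
  have AB : ∀ y ∈ J, lor (A y) (B y) = 1 := fun y hy => lor_lowerVec_upperVec (det y hy)
  have CC : ∀ y ∈ J, lor (C y) (C y) = 1 := fun y hy => lor_gaussVec_gaussVec (det y hy)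
  have dP : ∀ y ∈ J, HasDerivAt (fun u => rowP α β (Real.exp (-u)) y) (pt y) t := fun y hy =>
    (HasDerivAt.comp t (h₂ := fun v : ℝ => rowP α β v y)
      (hasDerivAt_rowP_param hJo hJc hJ0 cα cβ hy w) (hasDerivAt_exp_neg t)).congr_deriv
      (by rw [mul_comm])
  have dQ : ∀ y ∈ J, HasDerivAt (fun u => rowQ α β (Real.exp (-u)) y) (qt y) t := fun y hy =>
    (HasDerivAt.comp t (h₂ := fun v : ℝ => rowQ α β v y)
      (hasDerivAt_rowQ_param hJo hJc hJ0 cα cβ hy w) (hasDerivAt_exp_neg t)).congr_deriv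
      (by rw [mul_comm])
  have dR : ∀ y ∈ J, HasDerivAt (fun u => rowQ β α (Real.exp (-u)) y) (rt y) t := fun y hy =>
    (HasDerivAt.comp t (h₂ := fun v : ℝ => rowQ β α v y)
      (hasDerivAt_rowQ_param hJo hJc hJ0 cβ cα hy w) (hasDerivAt_exp_neg t)).congr_deriv
      (by rw [mul_comm])
  have dS : ∀ y ∈ J, HasDerivAt (fun u => rowP β α (Real.exp (-u)) y) (st y) t := fun y hy =>
    (HasDerivAt.comp t (h₂ := fun v : ℝ => rowP β α v y)
      (hasDerivAt_rowP_param hJo hJc hJ0 cβ cα hy w) (hasDerivAt_exp_neg t)).congr_deriv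
      (by rw [mul_comm])
  have hexp : ∀ u : ℝ, ((Real.exp u : ℝ) : ℂ) ≠ 0 := fun u => by
    exact_mod_cast (Real.exp_pos u).ne'
  refine ⟨fun p => γ p.2 + Q p • B p.2, fun p => C p.2 + (-(H * Q p)) • B p.2, fun x hx => ?_,
    isTimelikeCMC_of_frame hDo (fun x hx => (hD x hx).1.2) sγ sB sC hpar.smooth_ruling
      (fun _ _ => lor_lowerVec_lowerVec) AB (fun _ _ => lor_upperVec_upperVec) CC
      (fun _ _ => lor_lowerVec_gaussVec) (fun _ _ => lor_upperVec_gaussVec) dγ dB dC hv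
      hpar.deriv_ruling,
    γ ∘ ρ, A ∘ ρ, B ∘ ρ, C ∘ ρ, (fun y => -α y / g y) ∘ ρ, σ, Q,
    isNullFrenet_of_frame hSo hSc hρ sρ dρ sγ sA sB sC (fun _ _ => lor_lowerVec_lowerVec) AB
      (fun _ _ => lor_upperVec_upperVec) CC (fun _ _ => lor_lowerVec_gaussVec)
      (fun _ _ => lor_upperVec_gaussVec) dγ dA dB dC hv, fun y hy => ?_, hpar, fun x hx => ?_⟩
  · obtain ⟨⟨-, hy⟩, hab⟩ := hD x hx
    have hΦu : ∀ u : ℝ, Φ x ((Real.exp u : ℝ) : ℂ) =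
        !![((rowP α β (Real.exp (-u)) x.2 * (1 - a x.1 * iterInt β α 1 x.2)⁻¹ : ℝ) : ℂ),
          ((rowP α β (Real.exp (-u)) x.2 * (Real.exp u * a x.1) +
            rowQ α β (Real.exp (-u)) x.2 * (1 - a x.1 * iterInt β α 1 x.2) : ℝ) : ℂ);
          ((rowQ β α (Real.exp (-u)) x.2 * (1 - a x.1 * iterInt β α 1 x.2)⁻¹ : ℝ) : ℂ),
          ((rowQ β α (Real.exp (-u)) x.2 * (Real.exp u * a x.1) +
            rowP β α (Real.exp (-u)) x.2 * (1 - a x.1 * iterInt β α 1 x.2) : ℝ) : ℂ)] := by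
      intro u
      rw [hΦ x hx _ (hexp u), solLoop_exp, gaugeLoop_apply]
      simp
    have hdet : ∀ u : ℝ, rowP α β (Real.exp (-u)) x.2 * (1 - a x.1 * iterInt β α 1 x.2)⁻¹ *
        (rowQ β α (Real.exp (-u)) x.2 * (Real.exp u * a x.1) +
          rowP β α (Real.exp (-u)) x.2 * (1 - a x.1 * iterInt β α 1 x.2)) -
        (rowP α β (Real.exp (-u)) x.2 * (Real.exp u * a x.1) +
          rowQ α β (Real.exp (-u)) x.2 * (1 - a x.1 * iterInt β α 1 x.2)) *
        (rowQ β α (Real.exp (-u)) x.2 * (1 - a x.1 * iterInt β α 1 x.2)⁻¹) = 1 := by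
      intro u
      have h := rows_det_eq_one hJo hJc hJ0 cα cβ hy u
      field_simp
      linear_combination (1 - a x.1 * iterInt β α 1 x.2) * h
    have hz : HasDerivAt (fun u => Real.exp u * a x.1) (Real.exp t * a x.1) t :=
      (Real.hasDerivAt_exp t).mul_const _
    constructor
    · have h := isSymPoint_symVec hH hΦu hdet ((dP _ hy).mul_const _)
        (((dP _ hy).mul hz).add ((dQ _ hy).mul_const _)) ((dR _ hy).mul_const _)
        (((dR _ hy).mul hz).add ((dS _ hy).mul_const _))
      rw [symVec_gauge hH hab] at h
      exact h
    · have h := isGaussPoint_gaussVec (hΦu t) (hdet t)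
      rw [gaussVec_gauge hab] at h
      convert h using 3
      simp only [Q]
      field_simp
  · have h := isSymPoint_symVec (Φ := Ψs y) hH
      (fun u => (hs y hy _ (hexp u)).trans (solLoop_exp y u))
      (rows_det_eq_one hJo hJc hJ0 cα cβ hy) (dP y hy) (dQ y hy) (dR y hy) (dS y hy)
    rw [Function.comp, hρ y hy]
    exact h
  · simp only [bScroll, Function.comp, hρ x.2 (hD x hx).1.2]

end Scroll

end TimelikeCMC

end

theorem mainTheorem12
    (H : ℝ) (hH : H ≠ 0)
    (I J : Set ℝ) (hIo : IsOpen I) (hIc : I.OrdConnected) (hI0 : (0 : ℝ) ∈ I)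
    (hJo : IsOpen J) (hJc : J.OrdConnected) (hJ0 : (0 : ℝ) ∈ J)
    (f g R : ℝ → ℝ)
    (hf : ContDiffOn ℝ ∞ f I) (hg : ContDiffOn ℝ ∞ g J) (hR : ContDiffOn ℝ ∞ R J)
    (hf0 : ∀ x ∈ I, f x ≠ 0) (hg0 : ∀ y ∈ J, g y ≠ 0) :
    -- the two initial value problems are solvable in the loop group
    (∃ Ψp Ψs : ℝ → TimelikeCMC.Loop,
      TimelikeCMC.SolvesIVP I (TimelikeCMC.xiPrime H (fun _ => 0) f) Ψp ∧
      TimelikeCMC.SolvesIVP J (TimelikeCMC.xiSecond H R g) Ψs ∧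
      (∀ x ∈ I, Ψp x ∈ TimelikeCMC.loopGroup) ∧
      (∀ y ∈ J, Ψs y ∈ TimelikeCMC.loopGroup)) ∧
    -- whatever is produced from them is a B-scroll
    (∀ Ψp Ψs : ℝ → TimelikeCMC.Loop,
      TimelikeCMC.SolvesIVP I (TimelikeCMC.xiPrime H (fun _ => 0) f) Ψp →
      TimelikeCMC.SolvesIVP J (TimelikeCMC.xiSecond H R g) Ψs →
      IsOpen (TimelikeCMC.bigCell I J Ψp Ψs) ∧
      ((0 : ℝ), (0 : ℝ)) ∈ TimelikeCMC.bigCell I J Ψp Ψs ∧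
      ∀ Φ : ℝ × ℝ → TimelikeCMC.Loop,
        (∀ p ∈ TimelikeCMC.bigCell I J Ψp Ψs,
          TimelikeCMC.IsIwasawaFactor (Ψp p.1) (Ψs p.2) (Φ p)) →
        ∀ t : ℝ, ∃ φ N : ℝ × ℝ → TimelikeCMC.E31,
          (∀ p ∈ TimelikeCMC.bigCell I J Ψp Ψs,
            TimelikeCMC.IsSymPoint H (Φ p) t (φ p) ∧
            TimelikeCMC.IsGaussPoint (Φ p) t (N p)) ∧
          TimelikeCMC.IsTimelikeCMC (TimelikeCMC.bigCell I J Ψp Ψs) φ N H ∧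
          ∃ (γ A B C : ℝ → TimelikeCMC.E31) (κ σ : ℝ → ℝ) (q : ℝ × ℝ → ℝ),
            TimelikeCMC.IsNullFrenet (σ '' J) γ A B C κ (fun _ => H) ∧
            (∀ y ∈ J, TimelikeCMC.IsSymPoint H (Ψs y) t (γ (σ y))) ∧
            TimelikeCMC.IsScrollParam (TimelikeCMC.bigCell I J Ψp Ψs) J σ q ∧
            ∀ p ∈ TimelikeCMC.bigCell I J Ψp Ψs,
              φ p = TimelikeCMC.bScroll γ B (σ p.2, q p)) := by
  have sα : ContDiffOn ℝ ∞ (fun y => -(R y / g y)) J := (hR.div hg hg0).neg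
  have sβ : ContDiffOn ℝ ∞ (fun y => H / 2 * g y) J := contDiffOn_const.mul hg
  have cα := sα.continuousOn
  have cβ := sβ.continuousOn
  have ha : ∀ x ∈ I, HasDerivAt (fun x => ∫ u in (0 : ℝ)..x, -(H / 2) * f u)
      (-(H / 2) * f x) x := fun x hx => TimelikeCMC.hasDerivAt_integral_of_continuousOn
        (h := fun x => -(H / 2) * f x) hIo hIc hI0 (continuousOn_const.mul hf.continuousOn) hx
  have ha0 : (∫ u in (0 : ℝ)..0, -(H / 2) * f u) = 0 := intervalIntegral.integral_same
  set a : ℝ → ℝ := fun x => ∫ u in (0 : ℝ)..x, -(H / 2) * f u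
  set α : ℝ → ℝ := fun y => -(R y / g y)
  set β : ℝ → ℝ := fun y => H / 2 * g y
  have ivp₁ := fun Ψ => TimelikeCMC.solvesIVP_iff (I := I) (Ψ := Ψ)
    (TimelikeCMC.xiPrime_zero_apply H f)
  have ivp₂ := fun Ψ => TimelikeCMC.solvesIVP_iff (I := J) (Ψ := Ψ)
    (TimelikeCMC.xiSecond_apply H R g)
  have sol₁ := fun z => TimelikeCMC.solvesOffDiag_shearLoop ha0 ha z
  have sol₂ := fun z => TimelikeCMC.solvesOffDiag_solLoop hJo hJc hJ0 cα cβ z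
  refine ⟨⟨fun x => TimelikeCMC.shearLoop (a x), TimelikeCMC.solLoop α β,
    (ivp₁ _).2 fun z _ => sol₁ z, (ivp₂ _).2 fun z _ => sol₂ z,
    fun x _ => TimelikeCMC.shearLoop_mem_loopGroup _,
    fun y hy => ⟨TimelikeCMC.isTwistedUnimodular_solLoop hJo hJc hJ0 cα cβ hy, _,
      TimelikeCMC.hasLaurent_solLoop hJo hJc hJ0 cα cβ hy⟩⟩, fun Ψp Ψs hΨp hΨs => ?_⟩
  -- Uniqueness identifies arbitrary solutions with the explicit ones, but only on the intervals and
  -- for `z ≠ 0`.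
  have hp : ∀ x ∈ I, ∀ z ≠ 0, Ψp x z = TimelikeCMC.shearLoop (a x) z := fun x hx z hz =>
    ((ivp₁ _).1 hΨp z hz).unique hIo hIc hI0 (sol₁ z) hx
  have hs : ∀ y ∈ J, ∀ z ≠ 0, Ψs y z = TimelikeCMC.solLoop α β y z := fun y hy z hz =>
    ((ivp₂ _).1 hΨs z hz).unique hJo hJc hJ0 (sol₂ z) hy
  have hcell := TimelikeCMC.mem_bigCell_iff hJo hJc hJ0 hp cα cβ hs
  have hopen : IsOpen (TimelikeCMC.bigCell I J Ψp Ψs) := by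
    have heq : TimelikeCMC.bigCell I J Ψp Ψs = (I ×ˢ J) ∩
        (fun p : ℝ × ℝ => 1 - a p.1 * TimelikeCMC.iterInt β α 1 p.2) ⁻¹' {0}ᶜ :=
      Set.ext fun x => (hcell x).1
    rw [heq]
    have hac : ContinuousOn a I := fun x hx => (ha x hx).continuousAt.continuousWithinAt
    have hbc := TimelikeCMC.continuousOn_iterInt hJo hJc hJ0 cβ cα 1
    refine ContinuousOn.isOpen_inter_preimage ?_ (hIo.prod hJo) isOpen_compl_singleton
    exact continuousOn_const.sub ((hac.comp continuousOn_fst fun p hp => hp.1).mul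
      (hbc.comp continuousOn_snd fun p hp => hp.2))
  refine ⟨hopen, (hcell (0, 0)).1.2 ⟨⟨hI0, hJ0⟩, ?_⟩, fun Φ hΦ t => ?_⟩
  · have : a 0 = 0 := ha0
    simp [this]
  · exact TimelikeCMC.exists_scroll hIo hIc hJo hJc hJ0 hH hf hg sα sβ hf0 hg0
      (fun _ => rfl) ha hopen (fun p hp => (hcell p).1.1 hp) hs
      (fun p hp => (hcell p).2 (Φ p) hp.1 (hΦ p hp)) t
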